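/- Let $(M^n,g)$ be a smooth Riemannian manifold without boundary of dimension $n\ge 3$ (completeness is not needed), let $\lambda,m\in\mathbb R$ with $m\neq 0$, and let $f$ be a smooth function on $M$ such that $$\mathrm{Ric}+\mathrm{Hess} f-\tfrac1m\,df\otimes df=\lambda g .$$ (When $(M,g)$ is complete, $(M,g,f)$ is called a $(\lambda,n+m)$-Einstein manifold.) Let $\nabla$ be the Levi-Civita connection, $R(X,Y,Z,V)=g(\nabla_X\nabla_YZ-\nabla_Y\nabla_XZ-\nabla_{[X,Y]}Z,V)$, and let $\mathrm{Ric}(X,Y)=\sum_iR(E_i,X,Y,E_i)$ (for an orthonormal basis $E_i$) and $\mathrm{scal}$ be the Ricci and scalar curvatures. For symmetric $(0,2)$-tensors $s,r$ put $$(s\odot r)(X,Y,Z,V)=\tfrac12\big(r(X,V)s(Y,Z)+r(Y,Z)s(X,V)-r(X,Z)s(Y,V)-r(Y,V)s(X,Z)\big),$$ and define the Weyl tensor $W$ by $$R=W+\tfrac{2}{n-2}\mathrm{Ric}\odot g-\tfrac{\mathrm{scal}}{(n-1)(n-2)}\,g\odot g .$$ Let $S=\mathrm{Ric}-\frac{\mathrm{scal}}{2(n-1)}g$,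 let $C(X,Y,Z)=(\nabla_XS)(Y,Z)-(\nabla_YS)(X,Z)$ be the Cotton tensor, and let $$\begin{aligned}D(X,Y,Z)={}&\tfrac{1}{(n-1)(n-2)}\big(\mathrm{Ric}(X,\nabla f)g(Y,Z)-\mathrm{Ric}(Y,\nabla f)g(X,Z)\big)\\&+\tfrac1{n-2}\big(\mathrm{Ric}(Y,Z)g(X,\nabla f)-\mathrm{Ric}(X,Z)g(Y,\nabla f)\big)\\&-\tfrac{\mathrm{scal}}{(n-1)(n-2)}\big(g(X,\nabla f)g(Y,Z)-g(Y,\nabla f)g(X,Z)\big).\end{aligned}$$ Then for every $p\in M$ and all $X,Y,Z\in T_pM$, $$C(X,Y,Z)=W(X,Y,Z,\nabla f)+\frac{m+n-2}{m}\,D(X,Y,Z).$$ -/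

import Mathlib

open Bundle Manifold
open scoped ContDiff

noncomputable section

namespace RiemGeom

variable {n : ℕ} {M : Type*} [TopologicalSpace M] [ChartedSpace (EuclideanSpace ℝ (Fin n)) M]
  [IsManifold (𝓡 n) ∞ M]
  [RiemannianBundle (fun x : M ↦ TangentSpace (𝓡 n) x)]

/-- The Riemannian metric `g` at `x`. -/
def metric (x : M) (u v : TangentSpace (𝓡 n) x) : ℝ := inner ℝ u v

/-- A local extension of a tangent vector at `p` to a vector field, smooth near `p` (constant in the
trivialization of the tangent bundle at `p`). It is used only to evaluate tensorial expressions,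
whose value at `p` does not depend on the extension. -/
def localExt {p : M} (v : TangentSpace (𝓡 n) p) (x : M) : TangentSpace (𝓡 n) x :=
  FiberBundle.extend (EuclideanSpace ℝ (Fin n)) (E := fun x : M ↦ TangentSpace (𝓡 n) x) v x

/-- Tangent spaces are finite dimensional. -/
instance finiteDimensionalTangentSpace (x : M) : FiniteDimensional ℝ (TangentSpace (𝓡 n) x) :=
  inferInstanceAs (FiniteDimensional ℝ (EuclideanSpace ℝ (Fin n)))

/-- An orthonormal basis `E_1, …, E_n` of the tangent space at `x`. -/
def onb (x : M) :
    OrthonormalBasis (Fin (Module.finrank ℝ (TangentSpace (𝓡 n) x))) ℝ (TangentSpace (𝓡 n) x) :=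
  stdOrthonormalBasis ℝ (TangentSpace (𝓡 n) x)

/-- The directional derivative `D_u h = dh(u)` of a function at `x`. -/
def dirDeriv (h : M → ℝ) (x : M) (u : TangentSpace (𝓡 n) x) : ℝ := mvfderiv (𝓡 n) h x u

/-- The right-hand side of Koszul's formula
`2 g(∇_X Y, Z) = X g(Y,Z) + Y g(Z,X) - Z g(X,Y) + g([X,Y],Z) - g([X,Z],Y) - g([Y,Z],X)`, halved. -/
def koszul (X Y Z : Π x : M, TangentSpace (𝓡 n) x) (x : M) : ℝ :=
  (1 / 2) * (dirDeriv (fun y ↦ metric y (Y y) (Z y)) x (X x)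
    + dirDeriv (fun y ↦ metric y (Z y) (X y)) x (Y x)
    - dirDeriv (fun y ↦ metric y (X y) (Y y)) x (Z x)
    + metric x (VectorField.mlieBracket (𝓡 n) X Y x) (Z x)
    - metric x (VectorField.mlieBracket (𝓡 n) X Z x) (Y x)
    - metric x (VectorField.mlieBracket (𝓡 n) Y Z x) (X x))

/-- The Levi-Civita covariant derivative `∇_u Y` at `x`, for a vector field `Y` and `u ∈ T_x M`: the
tangent vector whose inner product with every `z ∈ T_x M` is given by Koszul's formula. -/
def covDeriv (Y : Π x : M, TangentSpace (𝓡 n) x) (x : M) (u : TangentSpace (𝓡 n) x) :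
    TangentSpace (𝓡 n) x :=
  ∑ i, koszul (localExt u) Y (localExt (onb x i)) x • onb x i

/-- The curvature operator `∇_X ∇_Y Z - ∇_Y ∇_X Z - ∇_[X,Y] Z` on vector fields. -/
def curvOp (X Y Z : Π x : M, TangentSpace (𝓡 n) x) (x : M) : TangentSpace (𝓡 n) x :=
  covDeriv (fun y ↦ covDeriv Z y (Y y)) x (X x)
    - covDeriv (fun y ↦ covDeriv Z y (X y)) x (Y x)
    - covDeriv Z x (VectorField.mlieBracket (𝓡 n) X Y x)

/-- The Riemann `(0,4)`-tensor `R(X,Y,Z,V) = g(R(X,Y)Z, V)`; so `R(X,Y,Y,X)` has the sign of the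
sectional curvature. -/
def riem (p : M) (u v w z : TangentSpace (𝓡 n) p) : ℝ :=
  metric p (curvOp (localExt u) (localExt v) (localExt w) p) z

/-- The Ricci tensor `Ric(X,Y) = ∑ R(E_i, X, Y, E_i)`. -/
def ric (p : M) (u v : TangentSpace (𝓡 n) p) : ℝ :=
  ∑ i, riem p (onb p i) u v (onb p i)

/-- The scalar curvature. -/
def scal (n : ℕ) {M : Type*} [TopologicalSpace M]
    [ChartedSpace (EuclideanSpace ℝ (Fin n)) M] [IsManifold (𝓡 n) ∞ M]
    [RiemannianBundle (fun x : M ↦ TangentSpace (𝓡 n) x)] (p : M) : ℝ :=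
  ∑ i, ric (n := n) p (onb p i) (onb p i)

/-- The Kulkarni-Nomizu product of two `(0,2)`-tensors at a point. -/
def kulkarniNomizu {p : M} (s r : TangentSpace (𝓡 n) p → TangentSpace (𝓡 n) p → ℝ)
    (x y z w : TangentSpace (𝓡 n) p) : ℝ :=
  (1 / 2) * (r x w * s y z + r y z * s x w - r x z * s y w - r y w * s x z)

/-- The Weyl tensor, defined by
`R = W + 2/(n-2) Ric ⊙ g - scal/((n-1)(n-2)) g ⊙ g`. -/
def weyl (p : M) (x y z w : TangentSpace (𝓡 n) p) : ℝ :=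
  riem p x y z w
    - 2 / ((n : ℝ) - 2) * kulkarniNomizu (ric p) (metric p) x y z w
    + scal n p / (((n : ℝ) - 1) * ((n : ℝ) - 2)) * kulkarniNomizu (metric p) (metric p) x y z w

/-- The Schouten tensor `S = Ric - scal/(2(n-1)) g`. -/
def schouten (p : M) (u v : TangentSpace (𝓡 n) p) : ℝ :=
  ric p u v - scal n p / (2 * ((n : ℝ) - 1)) * metric p u v

/-- The covariant derivative `(∇_u T)(v,w)` at `p` of a `(0,2)`-tensor field `T`:
`(∇_X T)(Y,Z) = X (T(Y,Z)) - T(∇_X Y, Z) - T(Y, ∇_X Z)`. -/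
def covDerivTensor (T : Π x : M, TangentSpace (𝓡 n) x → TangentSpace (𝓡 n) x → ℝ) (p : M)
    (u v w : TangentSpace (𝓡 n) p) : ℝ :=
  dirDeriv (fun x ↦ T x (localExt v x) (localExt w x)) p u
    - T p (covDeriv (localExt v) p u) w - T p v (covDeriv (localExt w) p u)

/-- The Cotton tensor `C(X,Y,Z) = (∇_X S)(Y,Z) - (∇_Y S)(X,Z)`. -/
def cotton (p : M) (x y z : TangentSpace (𝓡 n) p) : ℝ :=
  covDerivTensor schouten p x y z - covDerivTensor schouten p y x z

/-- The gradient of a function: `g(∇f, u) = df(u)`. -/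
def grad (f : M → ℝ) (x : M) : TangentSpace (𝓡 n) x :=
  (InnerProductSpace.toDual ℝ (TangentSpace (𝓡 n) x)).symm (mvfderiv (𝓡 n) f x)

/-- The Hessian `Hess f (X,Y) = g(∇_X ∇f, Y)`. -/
def hess (f : M → ℝ) (p : M) (u v : TangentSpace (𝓡 n) p) : ℝ :=
  metric p (covDeriv (grad f) p u) v

/-- The `(λ, n+m)`-Einstein equation `Ric + Hess f - (1/m) df ⊗ df = λ g` on `M`. -/
def EinsteinEquation (n : ℕ) {M : Type*} [TopologicalSpace M]
    [ChartedSpace (EuclideanSpace ℝ (Fin n)) M] [IsManifold (𝓡 n) ∞ M]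
    [RiemannianBundle (fun x : M ↦ TangentSpace (𝓡 n) x)] (lam m : ℝ) (f : M → ℝ) : Prop :=
  ∀ (p : M) (u v : TangentSpace (𝓡 n) p),
    ric p u v + hess f p u v - (1 / m) * (dirDeriv f p u * dirDeriv f p v) = lam * metric p u v

/-- The `D`-tensor of `(M, g, f)`. -/
def dTensor (f : M → ℝ) (p : M) (x y z : TangentSpace (𝓡 n) p) : ℝ :=
  1 / (((n : ℝ) - 1) * ((n : ℝ) - 2))
      * (ric p x (grad f p) * metric p y z - ric p y (grad f p) * metric p x z)
    + 1 / ((n : ℝ) - 2)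
      * (ric p y z * metric p x (grad f p) - ric p x z * metric p y (grad f p))
    - scal n p / (((n : ℝ) - 1) * ((n : ℝ) - 2))
      * (metric p x (grad f p) * metric p y z - metric p y (grad f p) * metric p x z)

end RiemGeom

end

/-! The identity compares two computations of the skew part of `∇ Ric`. Differentiating `Ric = λ g -
Hess f + (1/m) df ⊗ df` and antisymmetrizing in the first two arguments, the third derivatives of
`f` combine into a curvature term by the Ricci identity for `∇f`. Since `Hess f` is symmetric, the
other terms are `(1/m)` times `df` against `Hess f`, and the equation turns `Hess f` back into
`Ric`. This is `EinsteinEquation.covDerivTensor_ric_sub`: `(∇_X Ric)(Y,Z) - (∇_Y Ric)(X,Z) =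
R(X,Y,Z,∇f) + (1/m)(df(Y)(λ g - Ric)(X,Z) - df(X)(λ g - Ric)(Y,Z))`.

Tracing over `Y = Z` gives `d scal - div Ric` on the left, which is `½ d scal` by the contracted
second Bianchi identity (`dirDeriv_scal_eq_two_mul_div_ric`). So `EinsteinEquation.dirDeriv_scal`
expresses `d scal` by `Ric(·,∇f)` and `df`. The Cotton tensor is the skew part of `∇ Ric` corrected
by `d scal ⊗ g`. Substituting both formulas and splitting `R` into `W` and its Ricci part, the `λ`
terms cancel, and every remaining coefficient is `(m+n-2)/m` times that in `D`; for instance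
`1/(n-2) + 1/m = (m+n-2)/(m(n-2))` for `Ric(Y,Z) df(X)`.

The bulk of the file develops the Riemannian geometry needed for this from Koszul's formula: the
Levi-Civita connection, tensoriality and symmetries of the curvature, both Bianchi identities, and
the commutation of traces with `∇`. -/

set_option linter.unusedSectionVars false

/-! ### Smooth functions and smooth vector fields. -/

noncomputable section
namespace RiemGeom

variable {n : ℕ} {M : Type*} [TopologicalSpace M] [ChartedSpace (EuclideanSpace ℝ (Fin n)) M]

/-- Smoothness on `U` of a real-valued function. -/
def SmoothFun (U : Set M) (h : M → ℝ) : Prop := ContMDiffOn (𝓡 n) 𝓘(ℝ) ∞ h U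

variable {U : Set M} {h k : M → ℝ} {q : M}

lemma SmoothFun.mdiff (hh : SmoothFun (n := n) U h) (hU : IsOpen U) (hq : q ∈ U) :
    MDifferentiableAt (𝓡 n) 𝓘(ℝ) h q :=
  (ContMDiffOn.contMDiffAt hh (hU.mem_nhds hq)).mdifferentiableAt (by simp)

lemma SmoothFun.mono {V : Set M} (hh : SmoothFun (n := n) U h) (hV : V ⊆ U) :
    SmoothFun (n := n) V h := ContMDiffOn.mono hh hV

lemma smoothFun_const (c : ℝ) : SmoothFun (n := n) U (fun _ ↦ c) := contMDiffOn_const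

lemma SmoothFun.add (hh : SmoothFun (n := n) U h) (hk : SmoothFun (n := n) U k) :
    SmoothFun (n := n) U (fun x ↦ h x + k x) := ContMDiffOn.add hh hk

lemma SmoothFun.sub (hh : SmoothFun (n := n) U h) (hk : SmoothFun (n := n) U k) :
    SmoothFun (n := n) U (fun x ↦ h x - k x) := ContMDiffOn.sub hh hk

lemma SmoothFun.mul (hh : SmoothFun (n := n) U h) (hk : SmoothFun (n := n) U k) :
    SmoothFun (n := n) U (fun x ↦ h x * k x) := ContMDiffOn.mul hh hk

lemma SmoothFun.congr (hh : SmoothFun (n := n) U h) (hk : ∀ x ∈ U, k x = h x) :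
    SmoothFun (n := n) U k := ContMDiffOn.congr hh hk

lemma SmoothFun.sum {ι : Type*} {s : Finset ι} {h : ι → M → ℝ}
    (hh : ∀ i ∈ s, SmoothFun (n := n) U (h i)) :
    SmoothFun (n := n) U (fun x ↦ ∑ i ∈ s, h i x) := contMDiffOn_finsetSum hh

lemma SmoothFun.prod {ι : Type*} {s : Finset ι} {h : ι → M → ℝ}
    (hh : ∀ i ∈ s, SmoothFun (n := n) U (h i)) :
    SmoothFun (n := n) U (fun x ↦ ∏ i ∈ s, h i x) := contMDiffOn_finsetProd hh

lemma SmoothFun.inv (hh : SmoothFun (n := n) U h) (h0 : ∀ x ∈ U, h x ≠ 0) :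
    SmoothFun (n := n) U (fun x ↦ (h x)⁻¹) := ContMDiffOn.inv₀ hh h0

section
variable [IsManifold (𝓡 n) ∞ M]

/-- Smoothness on `U` of a vector field. -/
def SmoothField (U : Set M) (X : Π x : M, TangentSpace (𝓡 n) x) : Prop :=
  ContMDiffOn (𝓡 n) (𝓡 n).tangent ∞ (fun x ↦ (⟨x, X x⟩ : TangentBundle (𝓡 n) M)) U

variable {X Y Z : Π x : M, TangentSpace (𝓡 n) x}

lemma SmoothField.mdiff (hX : SmoothField U X) (hU : IsOpen U) (hq : q ∈ U) :
    MDifferentiableAt (𝓡 n) (𝓡 n).tangent (fun x ↦ (⟨x, X x⟩ : TangentBundle (𝓡 n) M)) q :=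
  (ContMDiffOn.contMDiffAt hX (hU.mem_nhds hq)).mdifferentiableAt (by simp)

lemma SmoothField.mono {V : Set M} (hX : SmoothField U X) (hV : V ⊆ U) :
    SmoothField V X := ContMDiffOn.mono hX hV

lemma SmoothField.congr (hX : SmoothField U X) (hY : ∀ x ∈ U, Y x = X x) :
    SmoothField U Y := ContMDiffOn.congr hX (fun x hx ↦ by rw [hY x hx])

lemma SmoothField.add (hX : SmoothField U X) (hY : SmoothField U Y) :
    SmoothField U (X + Y) := ContMDiffOn.add_section hX hY

lemma SmoothField.sub (hX : SmoothField U X) (hY : SmoothField U Y) :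
    SmoothField U (X - Y) := ContMDiffOn.sub_section hX hY

lemma SmoothField.smul (hh : SmoothFun (n := n) U h) (hX : SmoothField U X) :
    SmoothField U (h • X) := ContMDiffOn.smul_section hh hX

lemma SmoothField.sum {ι : Type*} {s : Finset ι} {X : ι → Π x : M, TangentSpace (𝓡 n) x}
    (hX : ∀ i ∈ s, SmoothField U (X i)) :
    SmoothField U (fun x ↦ ∑ i ∈ s, X i x) := ContMDiffOn.sum_section hX

lemma SmoothField.mlieBracket (hU : IsOpen U) (hX : SmoothField U X) (hY : SmoothField U Y) :
    SmoothField U (VectorField.mlieBracket (𝓡 n) X Y) := by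
  intro x hx
  -- The bracket costs one derivative, but `∞ + 1` is `∞`.
  have : IsManifold (𝓡 n) ((⊤ : ℕ∞) + 1) M := inferInstanceAs (IsManifold (𝓡 n) ∞ M)
  have : IsManifold (𝓡 n) (minSmoothness ℝ 2) M :=
    .of_le (n := ∞) (by simpa using (mod_cast le_top : ((2 : ℕ∞) : WithTop ℕ∞) ≤ ∞))
  refine ContMDiffAt.contMDiffWithinAt ?_
  exact ContMDiffAt.mlieBracket_vectorField (m := ⊤) (n := ⊤)
    (ContMDiffOn.contMDiffAt hX (hU.mem_nhds hx)) (ContMDiffOn.contMDiffAt hY (hU.mem_nhds hx))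
    (by simp)

/-- The function is the fibre component of the tangent map of `h` composed with the section `X`. -/
lemma SmoothFun.dirDeriv (hU : IsOpen U) (hh : SmoothFun (n := n) U h) (hX : SmoothField U X) :
    SmoothFun (n := n) U (fun x ↦ dirDeriv h x (X x)) := by
  have h1 := ContMDiffOn.contMDiffOn_tangentMapWithin (m := ∞) (n := ∞) hh (by simp)
    hU.uniqueMDiffOn
  have h2 : ContMDiffOn (𝓡 n) 𝓘(ℝ).tangent ∞
      (fun x ↦ tangentMapWithin (𝓡 n) 𝓘(ℝ) h U ⟨x, X x⟩) U :=
    h1.comp hX (fun x hx ↦ hx)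
  intro x hx
  have h3 := h2 x hx
  have h4 := (Bundle.contMDiffWithinAt_totalSpace.1 h3).2
  refine h4.congr (fun y hy ↦ ?_) ?_
  · simp [tangentMapWithin, RiemGeom.dirDeriv, mvfderiv, mfderivWithin_of_isOpen hU hy]
    rfl
  · simp [tangentMapWithin, RiemGeom.dirDeriv, mvfderiv, mfderivWithin_of_isOpen hU hx]
    rfl

end
end RiemGeom
end

/-! ### Directional derivatives, the metric and the Levi-Civita connection. -/

noncomputable section
namespace RiemGeom

/-- Differentiability at `q` of a real-valued function. -/
abbrev DiffFunAt {n : ℕ} {M : Type*} [TopologicalSpace M]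
    [ChartedSpace (EuclideanSpace ℝ (Fin n)) M] (h : M → ℝ) (q : M) : Prop :=
  MDifferentiableAt (𝓡 n) 𝓘(ℝ) h q

/-- Differentiability at `q` of a vector field. -/
abbrev DiffFieldAt {n : ℕ} {M : Type*} [TopologicalSpace M]
    [ChartedSpace (EuclideanSpace ℝ (Fin n)) M] [IsManifold (𝓡 n) ∞ M]
    (X : Π x : M, TangentSpace (𝓡 n) x) (q : M) : Prop :=
  MDifferentiableAt (𝓡 n) (𝓡 n).tangent (fun x ↦ (⟨x, X x⟩ : TangentBundle (𝓡 n) M)) q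

section dirDeriv
variable {n : ℕ} {M : Type*} [TopologicalSpace M] [ChartedSpace (EuclideanSpace ℝ (Fin n)) M]
  {h k : M → ℝ} {q : M}

lemma dirDeriv_add (hh : DiffFunAt (n := n) h q) (hk : DiffFunAt (n := n) k q)
    (u : TangentSpace (𝓡 n) q) :
    dirDeriv (fun x ↦ h x + k x) q u = dirDeriv h q u + dirDeriv k q u := by
  simp [dirDeriv, mvfderiv_fun_add hh hk]

lemma dirDeriv_sub (hh : DiffFunAt (n := n) h q) (hk : DiffFunAt (n := n) k q)
    (u : TangentSpace (𝓡 n) q) :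
    dirDeriv (fun x ↦ h x - k x) q u = dirDeriv h q u - dirDeriv k q u := by
  simp [dirDeriv, mvfderiv_fun_sub hh hk]

lemma dirDeriv_mul (hh : DiffFunAt (n := n) h q) (hk : DiffFunAt (n := n) k q)
    (u : TangentSpace (𝓡 n) q) :
    dirDeriv (fun x ↦ h x * k x) q u = h q * dirDeriv k q u + k q * dirDeriv h q u := by
  simp [dirDeriv, mvfderiv_fun_mul hh hk]

lemma dirDeriv_const (c : ℝ) (u : TangentSpace (𝓡 n) q) : dirDeriv (fun _ ↦ c) q u = 0 := by
  simp [dirDeriv, mvfderiv_const]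

lemma dirDeriv_const_mul (c : ℝ) (hh : DiffFunAt (n := n) h q) (u : TangentSpace (𝓡 n) q) :
    dirDeriv (fun x ↦ c * h x) q u = c * dirDeriv h q u := by
  rw [dirDeriv_mul mdifferentiableAt_const hh, dirDeriv_const]
  ring

lemma diffFunAt_sum {ι : Type*} (s : Finset ι) (h : ι → M → ℝ)
    (hh : ∀ i ∈ s, DiffFunAt (n := n) (h i) q) :
    DiffFunAt (n := n) (fun x ↦ ∑ i ∈ s, h i x) q := by
  classical
  induction s using Finset.induction_on with
  | empty => simpa using mdifferentiableAt_const
  | insert a s ha ih =>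
    simp only [Finset.mem_insert, forall_eq_or_imp] at hh
    simp only [Finset.sum_insert ha]
    exact MDifferentiableAt.add hh.1 (ih hh.2)

lemma dirDeriv_sum {ι : Type*} (s : Finset ι) (h : ι → M → ℝ)
    (hh : ∀ i ∈ s, DiffFunAt (n := n) (h i) q)
    (u : TangentSpace (𝓡 n) q) :
    dirDeriv (fun x ↦ ∑ i ∈ s, h i x) q u = ∑ i ∈ s, dirDeriv (h i) q u := by
  classical
  induction s using Finset.induction_on with
  | empty => simp [dirDeriv_const]
  | insert a s ha ih =>
    simp only [Finset.mem_insert, forall_eq_or_imp] at hh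
    simp only [Finset.sum_insert ha]
    rw [dirDeriv_add hh.1, ih hh.2]
    exact diffFunAt_sum s h hh.2

lemma dirDeriv_congr (hhk : h =ᶠ[nhds q] k) (u : TangentSpace (𝓡 n) q) :
    dirDeriv h q u = dirDeriv k q u := by
  have := hhk.mfderiv_eq (I := 𝓡 n) (I' := 𝓘(ℝ))
  simp only [dirDeriv, mvfderiv, ContinuousLinearMap.comp_apply]
  rw [this]
  rfl

lemma dirDeriv_add_right (u v : TangentSpace (𝓡 n) q) :
    dirDeriv h q (u + v) = dirDeriv h q u + dirDeriv h q v := map_add _ _ _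

lemma dirDeriv_smul_right (c : ℝ) (u : TangentSpace (𝓡 n) q) :
    dirDeriv h q (c • u) = c * dirDeriv h q u := map_smul _ _ _

end dirDeriv

variable {n : ℕ} {M : Type*} [TopologicalSpace M] [ChartedSpace (EuclideanSpace ℝ (Fin n)) M]
  [IsManifold (𝓡 n) ∞ M] [RiemannianBundle (fun x : M ↦ TangentSpace (𝓡 n) x)]

section metric
variable {q : M} (u v w : TangentSpace (𝓡 n) q) (c : ℝ)

lemma metric_comm : metric q u v = metric q v u := real_inner_comm _ _
lemma metric_add_left : metric q (u + v) w = metric q u w + metric q v w := inner_add_left _ _ _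
lemma metric_add_right : metric q w (u + v) = metric q w u + metric q w v := inner_add_right _ _ _
lemma metric_sub_left : metric q (u - v) w = metric q u w - metric q v w := inner_sub_left _ _ _
lemma metric_sub_right : metric q w (u - v) = metric q w u - metric q w v := inner_sub_right _ _ _
lemma metric_neg_left : metric q (-u) w = - metric q u w := inner_neg_left _ _
lemma metric_smul_left : metric q (c • u) w = c * metric q u w := real_inner_smul_left _ _ _
lemma metric_smul_right : metric q w (c • u) = c * metric q w u := real_inner_smul_right _ _ _
lemma metric_zero_left : metric q 0 w = 0 := inner_zero_left _
lemma metric_sum_left {ι : Type*} (s : Finset ι) (a : ι → TangentSpace (𝓡 n) q) :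
    metric q (∑ i ∈ s, a i) w = ∑ i ∈ s, metric q (a i) w := sum_inner _ _ _
lemma metric_sum_right {ι : Type*} (s : Finset ι) (a : ι → TangentSpace (𝓡 n) q) :
    metric q w (∑ i ∈ s, a i) = ∑ i ∈ s, metric q w (a i) := inner_sum _ _ _
variable {u v} in
lemma ext_metric (huv : ∀ z, metric q u z = metric q v z) : u = v := ext_inner_right ℝ huv

lemma metric_grad (f : M → ℝ) : metric q (grad f q) u = dirDeriv f q u :=
  InnerProductSpace.toDual_symm_apply

end metric

@[simp] lemma localExt_self {p : M} (v : TangentSpace (𝓡 n) p) : localExt v p = v :=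
  FiberBundle.extend_apply_self _ _

lemma localExt_mdiff {p : M} (v : TangentSpace (𝓡 n) p) : DiffFieldAt (localExt v) p :=
  FiberBundle.mdifferentiableAt_extend _ _ _

variable [IsContMDiffRiemannianBundle (𝓡 n) ∞ (EuclideanSpace ℝ (Fin n))
      (fun x : M ↦ TangentSpace (𝓡 n) x)]
  {X X' Y Y' Z Z' W V : Π x : M, TangentSpace (𝓡 n) x} {q : M} {U : Set M}

lemma SmoothFun.metric (hX : SmoothField U X) (hY : SmoothField U Y) :
    SmoothFun (n := n) U (fun x ↦ metric x (X x) (Y x)) := ContMDiffOn.inner_bundle hX hY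

lemma metric_mdiff (hX : DiffFieldAt X q) (hY : DiffFieldAt Y q) :
    DiffFunAt (n := n) (fun x ↦ metric x (X x) (Y x)) q := by
  have : IsContMDiffRiemannianBundle (𝓡 n) 1 (EuclideanSpace ℝ (Fin n))
      (fun x : M ↦ TangentSpace (𝓡 n) x) := .of_le (n := ∞) (by simp)
  exact hX.inner_bundle hY

/-- Koszul's formula is tensorial in its third argument. -/
lemma koszul_tensorial_right (hX : DiffFieldAt X q) (hY : DiffFieldAt Y q) :
    TensorialAt (𝓡 n) (EuclideanSpace ℝ (Fin n)) (fun Z ↦ koszul X Y Z q) q where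
  smul {f Z} hf hZ := by
    have e1 : (fun y ↦ metric y (Y y) ((f • Z) y)) = fun y ↦ f y * metric y (Y y) (Z y) := by
      funext y; exact metric_smul_right _ _ _
    have e2 : (fun y ↦ metric y ((f • Z) y) (X y)) = fun y ↦ f y * metric y (Z y) (X y) := by
      funext y; exact metric_smul_left _ _ _
    simp only [koszul, e1, e2]
    -- The derivatives of `f` along `X` and `Y` produced by the product rule cancel those produced
    -- by the brackets `[X, fZ]` and `[Y, fZ]`.
    rw [dirDeriv_mul hf (metric_mdiff hY hZ), dirDeriv_mul hf (metric_mdiff hZ hX),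
      VectorField.mlieBracket_smul_right hf hZ, VectorField.mlieBracket_smul_right hf hZ]
    simp only [Pi.smul_apply', dirDeriv_smul_right, metric_smul_left, metric_smul_right,
      metric_add_left, smul_eq_mul]
    rw [metric_comm (Z q) (Y q)]
    simp only [dirDeriv]
    ring
  add {Z Z'} hZ hZ' := by
    have e1 : (fun y ↦ metric y (Y y) ((Z + Z') y)) =
      fun y ↦ metric y (Y y) (Z y) + metric y (Y y) (Z' y) := by
      funext y; exact metric_add_right _ _ _
    have e2 : (fun y ↦ metric y ((Z + Z') y) (X y)) =
      fun y ↦ metric y (Z y) (X y) + metric y (Z' y) (X y) := by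
      funext y; exact metric_add_left _ _ _
    simp only [koszul, e1, e2]
    rw [dirDeriv_add (metric_mdiff hY hZ) (metric_mdiff hY hZ'),
      dirDeriv_add (metric_mdiff hZ hX) (metric_mdiff hZ' hX),
      VectorField.mlieBracket_add_right hZ hZ', VectorField.mlieBracket_add_right hZ hZ']
    simp only [Pi.add_apply, dirDeriv_add_right, metric_add_left, metric_add_right]
    ring

/-- Koszul's formula is tensorial in its first argument. -/
lemma koszul_tensorial_left (hY : DiffFieldAt Y q) (hZ : DiffFieldAt Z q) :
    TensorialAt (𝓡 n) (EuclideanSpace ℝ (Fin n)) (fun X ↦ koszul X Y Z q) q where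
  smul {f X} hf hX := by
    have e1 : (fun y ↦ metric y ((f • X) y) (Y y)) = fun y ↦ f y * metric y (X y) (Y y) := by
      funext y; exact metric_smul_left _ _ _
    have e2 : (fun y ↦ metric y (Z y) ((f • X) y)) = fun y ↦ f y * metric y (Z y) (X y) := by
      funext y; exact metric_smul_right _ _ _
    simp only [koszul, e1, e2]
    rw [dirDeriv_mul hf (metric_mdiff hX hY), dirDeriv_mul hf (metric_mdiff hZ hX),
      VectorField.mlieBracket_smul_left hf hX, VectorField.mlieBracket_smul_left hf hX]
    simp only [Pi.smul_apply', dirDeriv_smul_right, metric_smul_left, metric_smul_right,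
      metric_add_left, smul_eq_mul]
    rw [metric_comm (Z q) (X q)]
    simp only [dirDeriv]
    ring
  add {X X'} hX hX' := by
    have e1 : (fun y ↦ metric y ((X + X') y) (Y y)) =
      fun y ↦ metric y (X y) (Y y) + metric y (X' y) (Y y) := by
      funext y; exact metric_add_left _ _ _
    have e2 : (fun y ↦ metric y (Z y) ((X + X') y)) =
      fun y ↦ metric y (Z y) (X y) + metric y (Z y) (X' y) := by
      funext y; exact metric_add_right _ _ _
    simp only [koszul, e1, e2]
    rw [dirDeriv_add (metric_mdiff hX hY) (metric_mdiff hX' hY),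
      dirDeriv_add (metric_mdiff hZ hX) (metric_mdiff hZ hX'),
      VectorField.mlieBracket_add_left hX hX', VectorField.mlieBracket_add_left hX hX']
    simp only [Pi.add_apply, dirDeriv_add_right, metric_add_left, metric_add_right]
    ring

/-- The defining property of the Levi-Civita connection. -/
lemma metric_covDeriv (hX : DiffFieldAt X q) (hY : DiffFieldAt Y q) (hZ : DiffFieldAt Z q) :
    metric q (covDeriv Y q (X q)) (Z q) = koszul X Y Z q := by
  have hL := localExt_mdiff (X q)
  -- Definitional, since `TensorialAt.mkHom` evaluates on the same extension as `localExt`.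
  have key (z : TangentSpace (𝓡 n) q) :
      TensorialAt.mkHom _ q (koszul_tensorial_right hL hY) z
        = koszul (localExt (X q)) Y (localExt z) q := rfl
  have h1 : koszul X Y Z q = koszul (localExt (X q)) Y (localExt (Z q)) q := by
    rw [(koszul_tensorial_right hX hY).pointwise hZ (localExt_mdiff (Z q)) (by simp)]
    exact (koszul_tensorial_left hY (localExt_mdiff (Z q))).pointwise hX hL (by simp)
  -- `covDeriv` is defined by its components in `onb q`; linearity in the third slot passes from
  -- these to an arbitrary vector.
  have h2 : TensorialAt.mkHom _ q (koszul_tensorial_right hL hY) (Z q)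
      = ∑ i, metric q (onb q i) (Z q) * koszul (localExt (X q)) Y (localExt (onb q i)) q := by
    calc _ = TensorialAt.mkHom _ q (koszul_tensorial_right hL hY)
          (∑ i, metric q (onb q i) (Z q) • onb q i) := by
            congr 1; exact ((onb q).sum_repr' (Z q)).symm
      _ = _ := by
        rw [map_sum]
        exact Finset.sum_congr rfl fun i _ ↦ by rw [map_smul, key, smul_eq_mul]
  rw [h1, ← key, h2, covDeriv, metric_sum_left]
  simp only [metric_smul_left, mul_comm]

lemma metric_covDeriv_apply (hY : DiffFieldAt Y q) (hZ : DiffFieldAt Z q)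
    (u : TangentSpace (𝓡 n) q) :
    metric q (covDeriv Y q u) (Z q) = koszul (localExt u) Y Z q := by
  simpa using metric_covDeriv (localExt_mdiff u) hY hZ

lemma metric_covDeriv_apply_apply (hY : DiffFieldAt Y q) (u v : TangentSpace (𝓡 n) q) :
    metric q (covDeriv Y q u) v = koszul (localExt u) Y (localExt v) q := by
  simpa using metric_covDeriv_apply hY (localExt_mdiff v) u

/-- Torsion-freeness of the Levi-Civita connection. -/
lemma covDeriv_sub_covDeriv (hX : DiffFieldAt X q) (hY : DiffFieldAt Y q) :
    covDeriv Y q (X q) - covDeriv X q (Y q) = VectorField.mlieBracket (𝓡 n) X Y q := by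
  refine ext_metric fun z ↦ ?_
  have hz := localExt_mdiff z
  have h1 := metric_covDeriv hX hY hz
  have h2 := metric_covDeriv hY hX hz
  rw [localExt_self] at h1 h2
  rw [metric_sub_left, h1, h2]
  simp only [koszul, localExt_self]
  rw [VectorField.mlieBracket_swap_apply (V := Y) (W := X)]
  simp only [metric_neg_left]
  simp only [metric_comm]
  ring

/-- Metric compatibility of the Levi-Civita connection. -/
lemma dirDeriv_metric (hY : DiffFieldAt Y q) (hZ : DiffFieldAt Z q) (u : TangentSpace (𝓡 n) q) :
    dirDeriv (fun x ↦ metric x (Y x) (Z x)) q u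
      = metric q (covDeriv Y q u) (Z q) + metric q (Y q) (covDeriv Z q u) := by
  -- In the sum of the two Koszul expressions everything cancels except the derivative of `g(Y,Z)`
  -- along `u`, which occurs twice with factor `1/2`.
  rw [metric_comm (Y q), metric_covDeriv_apply hY hZ, metric_covDeriv_apply hZ hY]
  have e (A B : Π x : M, TangentSpace (𝓡 n) x) :
      (fun y ↦ metric y (A y) (B y)) = fun y ↦ metric y (B y) (A y) := by
    funext y; exact metric_comm _ _
  simp only [koszul, localExt_self]
  rw [VectorField.mlieBracket_swap_apply (V := Z) (W := Y), e Z Y, e Z (localExt u),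
    e Y (localExt u)]
  simp only [metric_neg_left]
  ring

lemma covDeriv_add_right (hY : DiffFieldAt Y q) (u v : TangentSpace (𝓡 n) q) :
    covDeriv Y q (u + v) = covDeriv Y q u + covDeriv Y q v := by
  refine ext_metric fun z ↦ ?_
  have hz := localExt_mdiff z
  have key (w : TangentSpace (𝓡 n) q) : metric q (covDeriv Y q w) z
      = TensorialAt.mkHom _ q (koszul_tensorial_left hY hz) w :=
    metric_covDeriv_apply_apply hY w z
  rw [metric_add_left, key, key, key, map_add]

lemma covDeriv_smul_right (hY : DiffFieldAt Y q) (c : ℝ) (u : TangentSpace (𝓡 n) q) :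
    covDeriv Y q (c • u) = c • covDeriv Y q u := by
  refine ext_metric fun z ↦ ?_
  have hz := localExt_mdiff z
  have key (w : TangentSpace (𝓡 n) q) : metric q (covDeriv Y q w) z
      = TensorialAt.mkHom _ q (koszul_tensorial_left hY hz) w :=
    metric_covDeriv_apply_apply hY w z
  rw [metric_smul_left, key, key, map_smul, smul_eq_mul]

lemma covDeriv_sub_right (hY : DiffFieldAt Y q) (u v : TangentSpace (𝓡 n) q) :
    covDeriv Y q (u - v) = covDeriv Y q u - covDeriv Y q v := by
  rw [sub_eq_add_neg, ← neg_one_smul ℝ v, covDeriv_add_right hY, covDeriv_smul_right hY,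
    neg_one_smul, sub_eq_add_neg]

lemma covDeriv_neg_right (hY : DiffFieldAt Y q) (u : TangentSpace (𝓡 n) q) :
    covDeriv Y q (-u) = -covDeriv Y q u := by
  rw [← neg_one_smul ℝ u, covDeriv_smul_right hY, neg_one_smul]

/-- Metric compatibility turns this into additivity of the directional derivative; `covDeriv_smul`
follows from the product rule in the same way. -/
lemma covDeriv_add (hY : DiffFieldAt Y q) (hZ : DiffFieldAt Z q) (u : TangentSpace (𝓡 n) q) :
    covDeriv (Y + Z) q u = covDeriv Y q u + covDeriv Z q u := by
  refine ext_metric fun z ↦ ?_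
  have hz := localExt_mdiff z
  have hYZ : DiffFieldAt (Y + Z) q := mdifferentiableAt_add_section hY hZ
  have h1 := dirDeriv_metric hYZ hz u
  have e : (fun x ↦ metric x ((Y + Z) x) (localExt z x)) =
      fun x ↦ metric x (Y x) (localExt z x) + metric x (Z x) (localExt z x) := by
    funext y; exact metric_add_left _ _ _
  rw [e, dirDeriv_add (metric_mdiff hY hz) (metric_mdiff hZ hz), dirDeriv_metric hY hz,
    dirDeriv_metric hZ hz] at h1
  simp only [localExt_self, Pi.add_apply, metric_add_left] at h1 ⊢
  linarith

lemma covDeriv_smul {h : M → ℝ} (hh : DiffFunAt (n := n) h q) (hY : DiffFieldAt Y q)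
    (u : TangentSpace (𝓡 n) q) :
    covDeriv (h • Y) q u = dirDeriv h q u • Y q + h q • covDeriv Y q u := by
  refine ext_metric fun z ↦ ?_
  have hz := localExt_mdiff z
  have hhY : DiffFieldAt (h • Y) q := hh.smul_section hY
  have h1 := dirDeriv_metric hhY hz u
  have e : (fun x ↦ metric x ((h • Y) x) (localExt z x)) =
      fun x ↦ h x * metric x (Y x) (localExt z x) := by
    funext y; exact metric_smul_left _ _ _
  rw [e, dirDeriv_mul hh (metric_mdiff hY hz), dirDeriv_metric hY hz] at h1
  simp only [localExt_self, Pi.smul_apply', metric_smul_left, metric_add_left] at h1 ⊢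
  linarith

lemma covDeriv_sub (hY : DiffFieldAt Y q) (hZ : DiffFieldAt Z q) (u : TangentSpace (𝓡 n) q) :
    covDeriv (Y - Z) q u = covDeriv Y q u - covDeriv Z q u := by
  have h := covDeriv_add (mdifferentiableAt_sub_section hY hZ) hZ u
  rw [sub_add_cancel] at h
  rw [h, add_sub_cancel_right]

/-- `[X, Y] h = X (Y h) - Y (X h)`. -/
lemma dirDeriv_mlieBracket {h : M → ℝ} (hU : IsOpen U) (hq : q ∈ U)
    (hh : SmoothFun (n := n) U h) (hX : SmoothField U X) (hY : SmoothField U Y) :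
    dirDeriv h q (VectorField.mlieBracket (𝓡 n) X Y q)
      = dirDeriv (fun x ↦ dirDeriv h x (Y x)) q (X q)
        - dirDeriv (fun x ↦ dirDeriv h x (X x)) q (Y q) := by
  rcases subsingleton_or_nontrivial (TangentSpace (𝓡 n) q) with hs | hs
  · simp [Subsingleton.elim _ (0 : TangentSpace (𝓡 n) q), dirDeriv]
  -- The formula is extracted from the Jacobi identity for `X`, `Y`, `hZ` with `Z q = z ≠ 0`:
  -- expanding by the Leibniz rule and subtracting `h` times the Jacobi identity for `X`, `Y`, `Z`
  -- leaves the claimed identity multiplied by `z`.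
  obtain ⟨z, hz⟩ := exists_ne (0 : TangentSpace (𝓡 n) q)
  set Z := localExt z with hZdef
  have hsub : IsManifold (𝓡 n) (minSmoothness ℝ 3) M :=
    .of_le (n := ∞) (by simpa using (mod_cast le_top : ((3 : ℕ∞) : WithTop ℕ∞) ≤ ∞))
  have hle : minSmoothness ℝ 2 ≤ ∞ := by
    simpa using (mod_cast le_top : ((2 : ℕ∞) : WithTop ℕ∞) ≤ ∞)
  obtain ⟨V, hV, hZV⟩ := FiberBundle.exists_contMDiffOn_extend (k := ∞) (𝓡 n)
    (EuclideanSpace ℝ (Fin n)) (V := fun x : M ↦ TangentSpace (𝓡 n) x) z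
  obtain ⟨V', hV'V, hV', hqV'⟩ := mem_nhds_iff.1 hV
  have hUV : IsOpen (U ∩ V') := hU.inter hV'
  have hqUV : q ∈ U ∩ V' := ⟨hq, hqV'⟩
  have hZ : SmoothField (U ∩ V') Z := ContMDiffOn.mono hZV (Set.inter_subset_right.trans hV'V)
  replace hh := hh.mono (V := U ∩ V') Set.inter_subset_left
  replace hX := hX.mono (V := U ∩ V') Set.inter_subset_left
  replace hY := hY.mono (V := U ∩ V') Set.inter_subset_left
  have hhZ := hZ.smul hh
  have jac (A : Π x : M, TangentSpace (𝓡 n) x) (hA : SmoothField (U ∩ V') A) :=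
    VectorField.leibniz_identity_mlieBracket_apply (I := 𝓡 n) (U := X) (V := Y) (W := A) (x := q)
    ((ContMDiffOn.contMDiffAt hX (hUV.mem_nhds hqUV)).of_le hle)
    ((ContMDiffOn.contMDiffAt hY (hUV.mem_nhds hqUV)).of_le hle)
    ((ContMDiffOn.contMDiffAt hA (hUV.mem_nhds hqUV)).of_le hle)
  have exp (A : Π x : M, TangentSpace (𝓡 n) x) (x) (hx : x ∈ U ∩ V') :
      VectorField.mlieBracket (𝓡 n) A (h • Z) x
        = ((fun x ↦ dirDeriv h x (A x)) • Z + h • VectorField.mlieBracket (𝓡 n) A Z) x :=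
    VectorField.mlieBracket_smul_right (hh.mdiff hUV hx) (hZ.mdiff hUV hx)
  have exp2 (A B : Π x : M, TangentSpace (𝓡 n) x) (hA : SmoothField (U ∩ V') A) :
      VectorField.mlieBracket (𝓡 n) B (VectorField.mlieBracket (𝓡 n) A (h • Z)) q
        = dirDeriv (fun x ↦ dirDeriv h x (A x)) q (B q) • z
          + dirDeriv h q (A q) • VectorField.mlieBracket (𝓡 n) B Z q
          + dirDeriv h q (B q) • VectorField.mlieBracket (𝓡 n) A Z q
          + h q • VectorField.mlieBracket (𝓡 n) B (VectorField.mlieBracket (𝓡 n) A Z) q := by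
    have hAh := hh.dirDeriv hUV hA
    have hAZ := SmoothField.mlieBracket hUV hA hZ
    have e1 : VectorField.mlieBracket (𝓡 n) A (h • Z) =ᶠ[nhds q]
        ((fun x ↦ dirDeriv h x (A x)) • Z + h • VectorField.mlieBracket (𝓡 n) A Z) :=
      Filter.eventually_of_mem (hUV.mem_nhds hqUV) (exp A)
    rw [Filter.EventuallyEq.mlieBracket_vectorField_eq (V := B) (V₁ := B)
      Filter.EventuallyEq.rfl e1,
      VectorField.mlieBracket_add_right ((hZ.smul hAh).mdiff hUV hqUV)
        ((hAZ.smul hh).mdiff hUV hqUV),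
      VectorField.mlieBracket_smul_right (hAh.mdiff hUV hqUV) (hZ.mdiff hUV hqUV),
      VectorField.mlieBracket_smul_right (hh.mdiff hUV hqUV) (hAZ.mdiff hUV hqUV)]
    simp only [hZdef, localExt_self]
    simp only [dirDeriv]
    module
  have j1 := jac (h • Z) hhZ
  have j2 := jac Z hZ
  rw [exp2 Y X hY, exp2 X Y hX, exp _ q hqUV, j2] at j1
  simp only [Pi.add_apply, Pi.smul_apply', hZdef, localExt_self] at j1
  have : (dirDeriv h q (VectorField.mlieBracket (𝓡 n) X Y q)
      - (dirDeriv (fun x ↦ dirDeriv h x (Y x)) q (X q)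
        - dirDeriv (fun x ↦ dirDeriv h x (X x)) q (Y q))) • z = 0 := by
    rw [← neg_eq_zero, ← sub_eq_zero.2 j1]
    module
  exact sub_eq_zero.1 ((smul_eq_zero.1 this).resolve_right hz)

end RiemGeom
end

/-! ### Local frames, Gram matrices and tensoriality over smooth functions. -/

noncomputable section
namespace RiemGeom

lemma SmoothFun.det {n : ℕ} {M : Type*} [TopologicalSpace M]
    [ChartedSpace (EuclideanSpace ℝ (Fin n)) M] {U : Set M}
    {ι : Type*} [Fintype ι] [DecidableEq ι] {A : M → Matrix ι ι ℝ}
    (hA : ∀ i j, SmoothFun (n := n) U (fun x ↦ A x i j)) :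
    SmoothFun (n := n) U (fun x ↦ (A x).det) := by
  simp only [Matrix.det_apply']
  exact .sum fun σ _ ↦ (smoothFun_const _).mul (.prod fun i _ ↦ hA _ _)

/-- Cramer's rule: each entry is a cofactor, a determinant in the entries of `A`, divided by `det
A`. -/
lemma SmoothFun.matrixInv {n : ℕ} {M : Type*} [TopologicalSpace M]
    [ChartedSpace (EuclideanSpace ℝ (Fin n)) M] {U : Set M}
    {ι : Type*} [Fintype ι] [DecidableEq ι] {A : M → Matrix ι ι ℝ}
    (hA : ∀ i j, SmoothFun (n := n) U (fun x ↦ A x i j)) (hdet : ∀ x ∈ U, (A x).det ≠ 0)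
    (i j : ι) : SmoothFun (n := n) U (fun x ↦ (A x)⁻¹ i j) := by
  simp only [Matrix.inv_def, Ring.inverse_eq_inv', Matrix.smul_apply, Matrix.adjugate_apply,
    smul_eq_mul]
  refine ((SmoothFun.det hA).inv hdet).mul (.det fun k l ↦ ?_)
  simp only [Matrix.updateRow_apply]
  split_ifs
  · exact smoothFun_const _
  · exact hA k l

variable {n : ℕ} {M : Type*} [TopologicalSpace M] [ChartedSpace (EuclideanSpace ℝ (Fin n)) M]
  [IsManifold (𝓡 n) ∞ M]

/-- The set on which the extensions `localExt v`, `v ∈ T_p M`, are smooth. -/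
def frameDomain (p : M) : Set M :=
  (trivializationAt (EuclideanSpace ℝ (Fin n)) (fun x : M ↦ TangentSpace (𝓡 n) x) p).baseSet

lemma isOpen_frameDomain (p : M) : IsOpen (frameDomain (n := n) p) :=
  Trivialization.open_baseSet _

lemma mem_frameDomain (p : M) : p ∈ frameDomain (n := n) p :=
  FiberBundle.mem_baseSet_trivializationAt' p

/-- In the trivialization at `p` this section has constant coordinates. -/
lemma smoothField_localExt {p : M} (v : TangentSpace (𝓡 n) p) :
    SmoothField (frameDomain (n := n) p) (localExt v) := by
  set t := trivializationAt (EuclideanSpace ℝ (Fin n)) (fun x : M ↦ TangentSpace (𝓡 n) x) p with ht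
  intro x hx
  have h1 : ContMDiffOn (𝓡 n) 𝓘(ℝ, EuclideanSpace ℝ (Fin n)) ∞
      (fun _ : M ↦ (t ⟨p, v⟩).2) t.baseSet := contMDiffOn_const
  refine (t.contMDiffWithinAt_section _ hx).2 ?_
  refine h1.congr (fun y hy ↦ ?_) x hx
  simp [localExt, FiberBundle.extend, ← ht, hy]

/-- `localExt` at a point of the frame domain, as a linear isomorphism. -/
def localExtEquiv (p : M) {x : M} (hx : x ∈ frameDomain (n := n) p) :
    TangentSpace (𝓡 n) p ≃ₗ[ℝ] TangentSpace (𝓡 n) x :=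
  ((trivializationAt (EuclideanSpace ℝ (Fin n)) (fun x : M ↦ TangentSpace (𝓡 n) x)
      p).linearEquivAt ℝ p (mem_frameDomain p)).trans
    ((trivializationAt (EuclideanSpace ℝ (Fin n)) (fun x : M ↦ TangentSpace (𝓡 n) x)
      p).linearEquivAt ℝ x hx).symm

lemma localExtEquiv_apply {p x : M} (hx : x ∈ frameDomain (n := n) p) (v : TangentSpace (𝓡 n) p) :
    localExtEquiv p hx v = localExt v x := rfl

variable [RiemannianBundle (fun x : M ↦ TangentSpace (𝓡 n) x)]

/-- The local frame at `p` extending the orthonormal basis `onb p`. -/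
def frame (p : M) (i : Fin (Module.finrank ℝ (TangentSpace (𝓡 n) p))) (x : M) :
    TangentSpace (𝓡 n) x := localExt (onb p i) x

@[simp] lemma frame_self (p : M) (i : Fin (Module.finrank ℝ (TangentSpace (𝓡 n) p))) :
    frame p i p = onb p i := localExt_self _

lemma smoothField_frame (p : M) (i : Fin (Module.finrank ℝ (TangentSpace (𝓡 n) p))) :
    SmoothField (frameDomain (n := n) p) (frame p i) := smoothField_localExt _

/-- The basis of `T_x M` given by the local frame at `p`. -/
def frameBasis (p : M) {x : M} (hx : x ∈ frameDomain (n := n) p) :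
    Module.Basis (Fin (Module.finrank ℝ (TangentSpace (𝓡 n) p))) ℝ (TangentSpace (𝓡 n) x) :=
  (onb p).toBasis.map (localExtEquiv p hx)

lemma frameBasis_apply {p x : M} (hx : x ∈ frameDomain (n := n) p) (i) :
    frameBasis p hx i = frame p i x := by
  simp [frameBasis, localExtEquiv_apply, frame]

/-- The Gram matrix of the local frame at `p`. -/
def gram (p x : M) : Matrix (Fin (Module.finrank ℝ (TangentSpace (𝓡 n) p)))
    (Fin (Module.finrank ℝ (TangentSpace (𝓡 n) p))) ℝ :=
  fun i j ↦ metric x (frame p i x) (frame p j x)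

lemma gram_det_ne_zero {p x : M} (hx : x ∈ frameDomain (n := n) p) :
    (gram (n := n) p x).det ≠ 0 := by
  have h := (frameBasis p hx).linearIndependent
  have e : ⇑(frameBasis p hx) = fun i ↦ frame p i x := funext (frameBasis_apply hx)
  rw [e] at h
  exact Matrix.det_gram_ne_zero_iff_linearIndependent.2 h

/-- The entries of the inverse Gram matrix of the local frame at `p`. -/
def gramInv (p : M) (i j : Fin (Module.finrank ℝ (TangentSpace (𝓡 n) p))) (x : M) : ℝ :=
  (gram (n := n) p x)⁻¹ i j

lemma sum_gram_mul_gramInv {p x : M} (hx : x ∈ frameDomain (n := n) p) (i j) :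
    ∑ k, gram (n := n) p x i k * gramInv (n := n) p k j x = if i = j then 1 else 0 := by
  have := Matrix.mul_nonsing_inv _ (gram_det_ne_zero hx).isUnit
  have := congrFun (congrFun this i) j
  rwa [Matrix.mul_apply, Matrix.one_apply] at this

lemma sum_gramInv_mul_gram {p x : M} (hx : x ∈ frameDomain (n := n) p) (i j) :
    ∑ k, gramInv (n := n) p i k x * gram (n := n) p x k j = if i = j then 1 else 0 := by
  have := Matrix.nonsing_inv_mul _ (gram_det_ne_zero hx).isUnit
  have := congrFun (congrFun this i) j
  rwa [Matrix.mul_apply, Matrix.one_apply] at this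

/-- Expansion of a tangent vector in the local frame. -/
lemma sum_metric_gramInv_smul_frame {p x : M} (hx : x ∈ frameDomain (n := n) p)
    (v : TangentSpace (𝓡 n) x) :
    ∑ j, (∑ i, metric x v (frame p i x) * gramInv (n := n) p i j x) • frame p j x = v := by
  set c := (frameBasis p hx).repr v with hc
  have hv : v = ∑ k, c k • frame p k x := by
    conv_lhs => rw [← (frameBasis p hx).sum_repr v]
    simp only [frameBasis_apply, hc]
  -- The vector of products `g(v, E_i)` is the coordinate vector times the Gram matrix, so the
  -- inverse Gram matrix recovers the coordinates.
  have hj (j) : ∑ i, metric x v (frame p i x) * gramInv (n := n) p i j x = c j := by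
    rw [hv]
    simp only [metric_sum_left, metric_smul_left, Finset.sum_mul]
    rw [Finset.sum_comm]
    have hk (k) : ∑ i, c k * metric x (frame p k x) (frame p i x) * gramInv (n := n) p i j x
        = c k * (if k = j then 1 else 0) := by
      rw [← sum_gram_mul_gramInv hx, Finset.mul_sum]
      exact Finset.sum_congr rfl fun i _ ↦ mul_assoc _ _ _
    simp [hk]
  simp only [hj]
  exact hv.symm

variable [IsContMDiffRiemannianBundle (𝓡 n) ∞ (EuclideanSpace ℝ (Fin n))
      (fun x : M ↦ TangentSpace (𝓡 n) x)]
  {X X' Y Y' Z Z' W V : Π x : M, TangentSpace (𝓡 n) x} {p q : M} {U : Set M}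

lemma smoothFun_gram (p : M) (i j) :
    SmoothFun (n := n) (frameDomain (n := n) p) (fun x ↦ gram (n := n) p x i j) :=
  .metric (smoothField_frame p i) (smoothField_frame p j)

lemma smoothFun_gramInv (p : M) (i j) :
    SmoothFun (n := n) (frameDomain (n := n) p) (gramInv (n := n) p i j) :=
  .matrixInv (smoothFun_gram p) (fun _ hx ↦ gram_det_ne_zero hx) i j

/-- A vector field is smooth if its inner products with all smooth vector fields are. -/
lemma smoothField_of_metric (hU : IsOpen U)
    (hV : ∀ (U' : Set M), IsOpen U' → U' ⊆ U → ∀ Z, SmoothField U' Z →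
      SmoothFun (n := n) U' (fun x ↦ metric x (V x) (Z x))) : SmoothField U V := by
  intro q hq
  refine ContMDiffAt.contMDiffWithinAt ?_
  have hU' : IsOpen (U ∩ frameDomain (n := n) q) := hU.inter (isOpen_frameDomain q)
  have h1 : SmoothField (U ∩ frameDomain (n := n) q) V := by
    -- The coefficients in the local frame at `q` are products of the functions `g(V, E_i)`, smooth
    -- by assumption, with inverse Gram entries.
    refine SmoothField.congr (X := fun x ↦ ∑ j,
      (∑ i, metric x (V x) (frame q i x) * gramInv (n := n) q i j x) • frame q j x) ?_
      fun x hx ↦ (sum_metric_gramInv_smul_frame hx.2 _).symm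
    refine SmoothField.sum fun j _ ↦ SmoothField.smul
      (h := fun x ↦ ∑ i, metric x (V x) (frame q i x) * gramInv (n := n) q i j x) (.sum fun i _ ↦ .mul ?_ ?_)
      ((smoothField_frame q j).mono Set.inter_subset_right)
    · exact hV _ hU' Set.inter_subset_left _ ((smoothField_frame q i).mono Set.inter_subset_right)
    · exact (smoothFun_gramInv q i j).mono Set.inter_subset_right
  exact ContMDiffOn.contMDiffAt h1 (hU'.mem_nhds ⟨hq, mem_frameDomain q⟩)

lemma SmoothFun.koszul (hU : IsOpen U) (hX : SmoothField U X) (hY : SmoothField U Y)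
    (hZ : SmoothField U Z) : SmoothFun (n := n) U (fun x ↦ koszul X Y Z x) := by
  unfold RiemGeom.koszul
  exact (smoothFun_const _).mul ((((((SmoothFun.metric hY hZ).dirDeriv hU hX).add
    ((SmoothFun.metric hZ hX).dirDeriv hU hY)).sub ((SmoothFun.metric hX hY).dirDeriv hU hZ)).add
    (.metric (.mlieBracket hU hX hY) hZ)).sub (.metric (.mlieBracket hU hX hZ) hY)
    |>.sub (.metric (.mlieBracket hU hY hZ) hX))

lemma SmoothField.covDeriv (hU : IsOpen U) (hY : SmoothField U Y) (hX : SmoothField U X) :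
    SmoothField U (fun x ↦ covDeriv Y x (X x)) := by
  refine smoothField_of_metric hU fun U' hU' hUU' Z hZ ↦ ?_
  refine (SmoothFun.koszul hU' (hX.mono hUU') (hY.mono hUU') hZ).congr fun x hx ↦ ?_
  exact metric_covDeriv ((hX.mono hUU').mdiff hU' hx) ((hY.mono hUU').mdiff hU' hx)
    (hZ.mdiff hU' hx)

lemma SmoothField.grad {f : M → ℝ} (hU : IsOpen U) (hf : SmoothFun (n := n) U f) :
    SmoothField (n := n) U (grad f) := by
  refine smoothField_of_metric hU fun U' hU' hUU' Z hZ ↦ ?_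
  exact ((hf.mono hUU').dirDeriv hU' hZ).congr fun x hx ↦ metric_grad _ _

/-- An operation on smooth vector fields on `U` which is linear over smooth functions on `U`, up to
evaluation at `q`. -/
structure IsTensorialOn {A : Type*} [AddCommGroup A] [Module ℝ A] (U : Set M) (q : M)
    (Φ : (Π x : M, TangentSpace (𝓡 n) x) → A) : Prop where
  smul : ∀ {h X}, SmoothFun (n := n) U h → SmoothField U X → Φ (h • X) = h q • Φ X
  add : ∀ {X Y}, SmoothField U X → SmoothField U Y → Φ (X + Y) = Φ X + Φ Y

namespace IsTensorialOn
variable {A : Type*} [AddCommGroup A] [Module ℝ A] {Φ : (Π x : M, TangentSpace (𝓡 n) x) → A}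

lemma congr (hΦ : IsTensorialOn U q Φ) (hq : q ∈ U) (hX : SmoothField U X) (hY : SmoothField U Y)
    (hXY : ∀ x ∈ U, X x = Y x) : Φ X = Φ Y := by
  classical
  -- Smoothness is required only on `U`, where `ψ` is constant, so no bump function is needed: `ψ •
  -- X` and `ψ • Y` are equal on all of `M`, and `ψ q = 1`.
  let ψ : M → ℝ := fun x ↦ if x ∈ U then 1 else 0
  have hψ : SmoothFun (n := n) U ψ := (smoothFun_const 1).congr fun x hx ↦ by simp [ψ, hx]
  have e : ψ • X = ψ • Y := by
    funext x
    by_cases hx : x ∈ U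
    · simp [hXY x hx]
    · simp [ψ, hx]
  have h1 := hΦ.smul hψ hX
  rw [e, hΦ.smul hψ hY] at h1
  simpa [ψ, hq] using h1.symm

lemma sum (hΦ : IsTensorialOn U q Φ) {ι : Type*} (s : Finset ι)
    (X : ι → Π x : M, TangentSpace (𝓡 n) x) (hX : ∀ i, SmoothField U (X i)) :
    Φ (fun x ↦ ∑ i ∈ s, X i x) = ∑ i ∈ s, Φ (X i) := by
  classical
  induction s using Finset.induction_on with
  | empty =>
    have h0 : SmoothField (n := n) U (fun x ↦ ∑ i ∈ (∅ : Finset ι), X i x) := .sum fun i _ ↦ hX i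
    have := hΦ.smul (smoothFun_const 0) h0
    simp only [zero_smul] at this
    rw [Finset.sum_empty, ← this]
    congr 1
    funext x
    simp
  | insert a s ha ih =>
    rw [Finset.sum_insert ha, ← ih, ← hΦ.add (hX a) (.sum fun i _ ↦ hX i)]
    congr 1
    funext x
    simp [Finset.sum_insert ha]

/-- A tensorial operation depends only on the value of the vector field at the point. -/
lemma pointwise (hΦ : IsTensorialOn U q Φ) (hq : q ∈ U) (hU : U ⊆ frameDomain (n := n) p)
    (hX : SmoothField U X) (hY : SmoothField U Y) (hXY : X q = Y q) : Φ X = Φ Y := by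
  let c (X : Π x : M, TangentSpace (𝓡 n) x) (j) : M → ℝ :=
    fun x ↦ ∑ i, metric x (X x) (frame p i x) * gramInv (n := n) p i j x
  have hc {X : Π x : M, TangentSpace (𝓡 n) x} (hX : SmoothField U X) (j) :
      SmoothFun (n := n) U (c X j) :=
    .sum fun i _ ↦ .mul (.metric hX ((smoothField_frame p i).mono hU))
      ((smoothFun_gramInv p i j).mono hU)
  have key {X : Π x : M, TangentSpace (𝓡 n) x} (hX : SmoothField U X) :
      Φ X = ∑ j, c X j q • Φ (frame p j) := by
    have hs (j) : SmoothField U (c X j • frame p j) :=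
      .smul (hc hX j) ((smoothField_frame p j).mono hU)
    -- The frame expansion of `X` is valid only inside the frame domain, hence the passage through
    -- `congr`.
    rw [hΦ.congr (Y := fun x ↦ ∑ j, (c X j • frame p j) x) hq hX (.sum fun j _ ↦ hs j)
      fun x hx ↦ (sum_metric_gramInv_smul_frame (hU hx) _).symm, hΦ.sum _ _ hs]
    exact Finset.sum_congr rfl fun j _ ↦ hΦ.smul (hc hX j) ((smoothField_frame p j).mono hU)
  rw [key hX, key hY]
  simp only [c, hXY]

end IsTensorialOn

end RiemGeom
end

/-! ### The curvature tensor, its symmetries and the Bianchi identities. -/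

noncomputable section
namespace RiemGeom

variable {n : ℕ} {M : Type*} [TopologicalSpace M] [ChartedSpace (EuclideanSpace ℝ (Fin n)) M]
  [IsManifold (𝓡 n) ∞ M] [RiemannianBundle (fun x : M ↦ TangentSpace (𝓡 n) x)]

/-- The vector field `∇_X Y`. -/
def nabla (X Y : Π x : M, TangentSpace (𝓡 n) x) (x : M) : TangentSpace (𝓡 n) x :=
  covDeriv Y x (X x)

lemma curvOp_apply (X Y Z : Π x : M, TangentSpace (𝓡 n) x) (x : M) :
    curvOp X Y Z x = nabla X (nabla Y Z) x - nabla Y (nabla X Z) x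
      - nabla (VectorField.mlieBracket (𝓡 n) X Y) Z x := rfl

lemma curvOp_eq (X Y Z : Π x : M, TangentSpace (𝓡 n) x) :
    curvOp X Y Z = nabla X (nabla Y Z) - nabla Y (nabla X Z)
      - nabla (VectorField.mlieBracket (𝓡 n) X Y) Z := rfl

variable [IsContMDiffRiemannianBundle (𝓡 n) ∞ (EuclideanSpace ℝ (Fin n))
      (fun x : M ↦ TangentSpace (𝓡 n) x)]
  {A X X' Y Y' Z Z' W V : Π x : M, TangentSpace (𝓡 n) x} {p q : M} {U : Set M} {h : M → ℝ}

lemma SmoothField.nabla (hU : IsOpen U) (hX : SmoothField U X) (hY : SmoothField U Y) :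
    SmoothField U (nabla X Y) := SmoothField.covDeriv hU hY hX

lemma SmoothField.curvOp (hU : IsOpen U) (hX : SmoothField U X) (hY : SmoothField U Y)
    (hZ : SmoothField U Z) : SmoothField U (curvOp X Y Z) :=
  ((hX.nabla hU (hY.nabla hU hZ)).sub (hY.nabla hU (hX.nabla hU hZ))).sub
    ((hX.mlieBracket hU hY).nabla hU hZ)

/-- Locality: Koszul's formula involves only values, first derivatives and brackets at `q`. -/
lemma covDeriv_congr (hYZ : Y =ᶠ[nhds q] Z) (u : TangentSpace (𝓡 n) q) :
    covDeriv Y q u = covDeriv Z q u := by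
  have hq := hYZ.eq_of_nhds
  refine Finset.sum_congr rfl fun i _ ↦ ?_
  congr 1
  simp only [koszul, hq]
  rw [dirDeriv_congr (k := fun y ↦ metric y (Z y) (localExt (onb q i) y))
      (hYZ.mono fun y hy ↦ by simp only [hy]),
    dirDeriv_congr (h := fun y ↦ metric y (localExt u y) (Y y))
      (k := fun y ↦ metric y (localExt u y) (Z y)) (hYZ.mono fun y hy ↦ by simp only [hy]),
    Filter.EventuallyEq.mlieBracket_vectorField_eq (V := localExt u) Filter.EventuallyEq.rfl hYZ,
    Filter.EventuallyEq.mlieBracket_vectorField_eq (W := localExt (onb q i)) hYZ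
      Filter.EventuallyEq.rfl]

lemma nabla_congr (hU : IsOpen U) (hq : q ∈ U) (hYZ : ∀ x ∈ U, Y x = Z x) :
    nabla X Y q = nabla X Z q :=
  covDeriv_congr (Filter.eventually_of_mem (hU.mem_nhds hq) hYZ) _

lemma nabla_smul_left (hY : DiffFieldAt Y q) : nabla (h • X) Y q = h q • nabla X Y q :=
  covDeriv_smul_right hY _ _

lemma nabla_add_left (hY : DiffFieldAt Y q) :
    nabla (X + X') Y q = nabla X Y q + nabla X' Y q := covDeriv_add_right hY _ _

lemma nabla_smul (hh : DiffFunAt (n := n) h q) (hY : DiffFieldAt Y q) :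
    nabla X (h • Y) q = dirDeriv h q (X q) • Y q + h q • nabla X Y q := covDeriv_smul hh hY _

lemma nabla_add (hY : DiffFieldAt Y q) (hZ : DiffFieldAt Z q) :
    nabla X (Y + Z) q = nabla X Y q + nabla X Z q := covDeriv_add hY hZ _

lemma nabla_sub (hY : DiffFieldAt Y q) (hZ : DiffFieldAt Z q) :
    nabla X (Y - Z) q = nabla X Y q - nabla X Z q := covDeriv_sub hY hZ _

lemma nabla_sub_nabla (hX : DiffFieldAt X q) (hY : DiffFieldAt Y q) :
    nabla X Y q - nabla Y X q = VectorField.mlieBracket (𝓡 n) X Y q := covDeriv_sub_covDeriv hX hY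

lemma curvOp_swap (hZ : DiffFieldAt Z q) : curvOp X Y Z q = -curvOp Y X Z q := by
  have : nabla (VectorField.mlieBracket (𝓡 n) X Y) Z q
      = -nabla (VectorField.mlieBracket (𝓡 n) Y X) Z q := by
    simp only [nabla]
    rw [VectorField.mlieBracket_swap_apply, covDeriv_neg_right hZ]
  rw [curvOp_apply, curvOp_apply, this]
  abel

/-- The term `dh(Y) ∇_X Z` from `∇_Y (h ∇_X Z)` cancels the one from `[hX, Y] = h [X, Y] - dh(Y) X`.
As second derivatives occur, smoothness on a neighbourhood is used, which is why `IsTensorialOn`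
replaces `TensorialAt` here. -/
lemma curvOp_tensorial_left (hU : IsOpen U) (hq : q ∈ U) (hY : SmoothField U Y)
    (hZ : SmoothField U Z) : IsTensorialOn U q (fun X ↦ curvOp X Y Z q) where
  smul {h X} hh hX := by
    have hZq := hZ.mdiff hU hq
    have hXZ := hX.nabla hU hZ
    have e1 : nabla Y (nabla (h • X) Z) q = nabla Y (h • nabla X Z) q :=
      nabla_congr hU hq fun x hx ↦ nabla_smul_left (hZ.mdiff hU hx)
    have e2 : nabla (VectorField.mlieBracket (𝓡 n) (h • X) Y) Z q
        = -dirDeriv h q (Y q) • nabla X Z q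
          + h q • nabla (VectorField.mlieBracket (𝓡 n) X Y) Z q := by
      simp only [nabla]
      rw [VectorField.mlieBracket_smul_left (hh.mdiff hU hq) (hX.mdiff hU hq),
        covDeriv_add_right hZq, covDeriv_smul_right hZq, covDeriv_smul_right hZq]
      rfl
    simp only [curvOp_apply]
    rw [e1, e2, nabla_smul_left ((hY.nabla hU hZ).mdiff hU hq),
      nabla_smul (hh.mdiff hU hq) (hXZ.mdiff hU hq)]
    module
  add {X X'} hX hX' := by
    have hZq := hZ.mdiff hU hq
    have e1 : nabla Y (nabla (X + X') Z) q = nabla Y (nabla X Z + nabla X' Z) q :=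
      nabla_congr hU hq fun x hx ↦ nabla_add_left (hZ.mdiff hU hx)
    have e2 : nabla (VectorField.mlieBracket (𝓡 n) (X + X') Y) Z q
        = nabla (VectorField.mlieBracket (𝓡 n) X Y) Z q
          + nabla (VectorField.mlieBracket (𝓡 n) X' Y) Z q := by
      simp only [nabla]
      rw [VectorField.mlieBracket_add_left (hX.mdiff hU hq) (hX'.mdiff hU hq),
        covDeriv_add_right hZq]
    simp only [curvOp_apply]
    rw [e1, e2, nabla_add_left ((hY.nabla hU hZ).mdiff hU hq),
      nabla_add ((hX.nabla hU hZ).mdiff hU hq) ((hX'.nabla hU hZ).mdiff hU hq)]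
    abel

lemma curvOp_tensorial_middle (hU : IsOpen U) (hq : q ∈ U) (hX : SmoothField U X)
    (hZ : SmoothField U Z) : IsTensorialOn U q (fun Y ↦ curvOp X Y Z q) where
  smul {h Y} hh hY := by
    have hZq := hZ.mdiff hU hq
    simp only [curvOp_swap (X := X) hZq]
    rw [(curvOp_tensorial_left hU hq hX hZ).smul hh hY, smul_neg]
  add {Y Y'} hY hY' := by
    have hZq := hZ.mdiff hU hq
    simp only [curvOp_swap (X := X) hZq]
    rw [(curvOp_tensorial_left hU hq hX hZ).add hY hY', neg_add]

/-- The first-order terms in `h` are symmetric in `X` and `Y`; the second-order ones are cancelled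
by `[X, Y] h`, using `dirDeriv_mlieBracket`. -/
lemma curvOp_tensorial_right (hU : IsOpen U) (hq : q ∈ U) (hX : SmoothField U X)
    (hY : SmoothField U Y) : IsTensorialOn U q (fun Z ↦ curvOp X Y Z q) where
  smul {h Z} hh hZ := by
    have hZq := hZ.mdiff hU hq
    have hhq := hh.mdiff hU hq
    have key {X Y : Π x : M, TangentSpace (𝓡 n) x} (hX : SmoothField U X)
        (hY : SmoothField U Y) : nabla X (nabla Y (h • Z)) q =
          dirDeriv (fun x ↦ dirDeriv h x (Y x)) q (X q) • Z q
          + dirDeriv h q (Y q) • nabla X Z q + dirDeriv h q (X q) • nabla Y Z q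
          + h q • nabla X (nabla Y Z) q := by
      have hYh := hh.dirDeriv hU hY
      have e : nabla X (nabla Y (h • Z)) q
          = nabla X ((fun x ↦ dirDeriv h x (Y x)) • Z + h • nabla Y Z) q :=
        nabla_congr hU hq fun x hx ↦ nabla_smul (hh.mdiff hU hx) (hZ.mdiff hU hx)
      rw [e, nabla_add ((hZ.smul hYh).mdiff hU hq) (((hY.nabla hU hZ).smul hh).mdiff hU hq),
        nabla_smul (hYh.mdiff hU hq) hZq, nabla_smul hhq ((hY.nabla hU hZ).mdiff hU hq)]
      module
    simp only [curvOp_apply]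
    rw [key hX hY, key hY hX, nabla_smul hhq hZq, dirDeriv_mlieBracket hU hq hh hX hY]
    module
  add {Z Z'} hZ hZ' := by
    have key {X Y : Π x : M, TangentSpace (𝓡 n) x} (hY : SmoothField U Y) :
        nabla X (nabla Y (Z + Z')) q = nabla X (nabla Y Z) q + nabla X (nabla Y Z') q := by
      have e : nabla X (nabla Y (Z + Z')) q = nabla X (nabla Y Z + nabla Y Z') q :=
        nabla_congr hU hq fun x hx ↦ nabla_add (hZ.mdiff hU hx) (hZ'.mdiff hU hx)
      rw [e, nabla_add ((hY.nabla hU hZ).mdiff hU hq) ((hY.nabla hU hZ').mdiff hU hq)]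
    simp only [curvOp_apply]
    rw [key hX, key hY, nabla_add (hZ.mdiff hU hq) (hZ'.mdiff hU hq)]
    abel

/-- The curvature operator `R(u, v) w` on tangent vectors. -/
def curvAt (q : M) (u v w : TangentSpace (𝓡 n) q) : TangentSpace (𝓡 n) q :=
  curvOp (localExt u) (localExt v) (localExt w) q

lemma riem_eq (q : M) (u v w z : TangentSpace (𝓡 n) q) :
    riem q u v w z = metric q (curvAt q u v w) z := rfl

/-- The curvature operator is a tensor. -/
lemma curvOp_eq_curvAt (hU : IsOpen U) (hq : q ∈ U) (hX : SmoothField U X) (hY : SmoothField U Y)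
    (hZ : SmoothField U Z) : curvOp X Y Z q = curvAt q (X q) (Y q) (Z q) := by
  -- `IsTensorialOn.pointwise` needs a domain on which the frame is defined.
  have hU' : IsOpen (U ∩ frameDomain (n := n) q) := hU.inter (isOpen_frameDomain q)
  have hq' : q ∈ U ∩ frameDomain (n := n) q := ⟨hq, mem_frameDomain q⟩
  have hs : U ∩ frameDomain (n := n) q ⊆ frameDomain (n := n) q := Set.inter_subset_right
  replace hX := hX.mono (V := U ∩ frameDomain (n := n) q) Set.inter_subset_left
  replace hY := hY.mono (V := U ∩ frameDomain (n := n) q) Set.inter_subset_left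
  replace hZ := hZ.mono (V := U ∩ frameDomain (n := n) q) Set.inter_subset_left
  have hX' := (smoothField_localExt (X q)).mono hs
  have hY' := (smoothField_localExt (Y q)).mono hs
  have hZ' := (smoothField_localExt (Z q)).mono hs
  calc curvOp X Y Z q = curvOp (localExt (X q)) Y Z q :=
        (curvOp_tensorial_left hU' hq' hY hZ).pointwise hq' hs hX hX' (by simp)
    _ = curvOp (localExt (X q)) (localExt (Y q)) Z q :=
        (curvOp_tensorial_middle hU' hq' hX' hZ).pointwise hq' hs hY hY' (by simp)
    _ = curvOp (localExt (X q)) (localExt (Y q)) (localExt (Z q)) q :=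
        (curvOp_tensorial_right hU' hq' hX' hY').pointwise hq' hs hZ hZ' (by simp)

section pointwise
variable (u u' v v' w w' z z' : TangentSpace (𝓡 n) q) (c : ℝ)

lemma curvAt_add_left : curvAt q (u + u') v w = curvAt q u v w + curvAt q u' v w := by
  have h1 := (curvOp_tensorial_left (isOpen_frameDomain q) (mem_frameDomain q)
    (smoothField_localExt v) (smoothField_localExt w)).add (smoothField_localExt u)
    (smoothField_localExt u')
  rw [curvOp_eq_curvAt (isOpen_frameDomain q) (mem_frameDomain q) ((smoothField_localExt u).add
    (smoothField_localExt u')) (smoothField_localExt v) (smoothField_localExt w)] at h1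
  simpa [curvAt] using h1

lemma curvAt_smul_left : curvAt q (c • u) v w = c • curvAt q u v w := by
  have h1 := (curvOp_tensorial_left (isOpen_frameDomain q) (mem_frameDomain q)
    (smoothField_localExt v) (smoothField_localExt w)).smul (smoothFun_const c)
    (smoothField_localExt u)
  rw [curvOp_eq_curvAt (isOpen_frameDomain q) (mem_frameDomain q) ((smoothField_localExt u).smul
    (smoothFun_const c)) (smoothField_localExt v) (smoothField_localExt w)] at h1
  simpa [curvAt] using h1

lemma curvAt_swap : curvAt q u v w = -curvAt q v u w := curvOp_swap (localExt_mdiff w)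

lemma curvAt_add_right : curvAt q u v (w + w') = curvAt q u v w + curvAt q u v w' := by
  have h1 := (curvOp_tensorial_right (isOpen_frameDomain q) (mem_frameDomain q)
    (smoothField_localExt u) (smoothField_localExt v)).add (smoothField_localExt w)
    (smoothField_localExt w')
  rw [curvOp_eq_curvAt (isOpen_frameDomain q) (mem_frameDomain q) (smoothField_localExt u)
    (smoothField_localExt v) ((smoothField_localExt w).add (smoothField_localExt w'))] at h1
  simpa [curvAt] using h1

lemma curvAt_smul_right : curvAt q u v (c • w) = c • curvAt q u v w := by
  have h1 := (curvOp_tensorial_right (isOpen_frameDomain q) (mem_frameDomain q)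
    (smoothField_localExt u) (smoothField_localExt v)).smul (smoothFun_const c)
    (smoothField_localExt w)
  rw [curvOp_eq_curvAt (isOpen_frameDomain q) (mem_frameDomain q) (smoothField_localExt u)
    (smoothField_localExt v) ((smoothField_localExt w).smul (smoothFun_const c))] at h1
  simpa [curvAt] using h1

lemma curvAt_add_middle : curvAt q u (v + v') w = curvAt q u v w + curvAt q u v' w := by
  rw [curvAt_swap, curvAt_add_left, curvAt_swap v, curvAt_swap v', neg_add, neg_neg, neg_neg]

lemma curvAt_smul_middle : curvAt q u (c • v) w = c • curvAt q u v w := by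
  rw [curvAt_swap, curvAt_smul_left, curvAt_swap v, smul_neg, neg_neg]

end pointwise

/-- The Jacobi identity in cyclic form. -/
lemma mlieBracket_cyclic (hU : IsOpen U) (hq : q ∈ U) (hX : SmoothField U X)
    (hY : SmoothField U Y) (hZ : SmoothField U Z) :
    VectorField.mlieBracket (𝓡 n) X (VectorField.mlieBracket (𝓡 n) Y Z) q
      + VectorField.mlieBracket (𝓡 n) Y (VectorField.mlieBracket (𝓡 n) Z X) q
      + VectorField.mlieBracket (𝓡 n) Z (VectorField.mlieBracket (𝓡 n) X Y) q = 0 := by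
  have : IsManifold (𝓡 n) (minSmoothness ℝ 3) M :=
    .of_le (n := ∞) (by simpa using (mod_cast le_top : ((3 : ℕ∞) : WithTop ℕ∞) ≤ ∞))
  have hle : minSmoothness ℝ 2 ≤ ∞ := by
    simpa using (mod_cast le_top : ((2 : ℕ∞) : WithTop ℕ∞) ≤ ∞)
  have j := VectorField.leibniz_identity_mlieBracket_apply (I := 𝓡 n) (U := X) (V := Y) (W := Z)
    ((ContMDiffOn.contMDiffAt hX (hU.mem_nhds hq)).of_le hle)
    ((ContMDiffOn.contMDiffAt hY (hU.mem_nhds hq)).of_le hle)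
    ((ContMDiffOn.contMDiffAt hZ (hU.mem_nhds hq)).of_le hle)
  have e : VectorField.mlieBracket (𝓡 n) Y (VectorField.mlieBracket (𝓡 n) Z X) q
      = -VectorField.mlieBracket (𝓡 n) Y (VectorField.mlieBracket (𝓡 n) X Z) q := by
    rw [VectorField.mlieBracket_swap (V := Z) (W := X), ← neg_one_smul ℝ,
      VectorField.mlieBracket_const_smul_right ((hX.mlieBracket hU hZ).mdiff hU hq), neg_one_smul]
  rw [j, e, VectorField.mlieBracket_swap_apply (V := Z)]
  abel

/-- The first Bianchi identity. -/
lemma curvAt_cyclic (u v w : TangentSpace (𝓡 n) q) :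
    curvAt q u v w + curvAt q v w u + curvAt q w u v = 0 := by
  have hU := isOpen_frameDomain (n := n) q
  have hq := mem_frameDomain (n := n) q
  have hX := smoothField_localExt u
  have hY := smoothField_localExt v
  have hZ := smoothField_localExt w
  simp only [curvAt, curvOp_apply]
  generalize localExt u = X at *
  generalize localExt v = Y at *
  generalize localExt w = Z at *
  -- Torsion-freeness, once inside the derivative and once outside, reduces the cyclic sum to the
  -- Jacobi identity.
  have key {X Y Z : Π x : M, TangentSpace (𝓡 n) x} (hX : SmoothField (frameDomain (n := n) q) X)
      (hY : SmoothField (frameDomain (n := n) q) Y) (hZ : SmoothField (frameDomain (n := n) q) Z) :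
      nabla X (nabla Y Z) q - nabla X (nabla Z Y) q
        = nabla (VectorField.mlieBracket (𝓡 n) Y Z) X q
          + VectorField.mlieBracket (𝓡 n) X (VectorField.mlieBracket (𝓡 n) Y Z) q := by
    have h1 : nabla X (nabla Y Z - nabla Z Y) q
        = nabla X (VectorField.mlieBracket (𝓡 n) Y Z) q :=
      nabla_congr hU hq fun x hx ↦ nabla_sub_nabla (hY.mdiff hU hx) (hZ.mdiff hU hx)
    rw [nabla_sub ((hY.nabla hU hZ).mdiff hU hq) ((hZ.nabla hU hY).mdiff hU hq)] at h1
    rw [h1, ← nabla_sub_nabla (hX.mdiff hU hq) ((hY.mlieBracket hU hZ).mdiff hU hq)]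
    abel
  have k1 := key hX hY hZ
  have k2 := key hY hZ hX
  have k3 := key hZ hX hY
  have j := mlieBracket_cyclic hU hq hX hY hZ
  rw [← sub_eq_iff_eq_add'] at k1 k2 k3
  rw [← k1, ← k2, ← k3] at j
  rw [← j]
  abel

/-- The function `g(Z,W)` is differentiated twice. In the commutator of `X` and `Y` the mixed
products of first derivatives cancel, and comparison with `[X, Y] g(Z,W)` leaves `g(R(X,Y)Z, W) +
g(Z, R(X,Y)W) = 0`. -/
lemma metric_curvOp_swap (hU : IsOpen U) (hq : q ∈ U) (hX : SmoothField U X)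
    (hY : SmoothField U Y) (hZ : SmoothField U Z) (hW : SmoothField U W) :
    metric q (curvOp X Y Z q) (W q) = -metric q (curvOp X Y W q) (Z q) := by
  have key {X Y : Π x : M, TangentSpace (𝓡 n) x} (hX : SmoothField U X) (hY : SmoothField U Y) :
      dirDeriv (fun x ↦ dirDeriv (fun y ↦ metric y (Z y) (W y)) x (Y x)) q (X q)
        = metric q (nabla X (nabla Y Z) q) (W q) + metric q (nabla Y Z q) (nabla X W q)
          + (metric q (nabla X Z q) (nabla Y W q) + metric q (Z q) (nabla X (nabla Y W) q)) := by
    have hYZ := hY.nabla hU hZ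
    have hYW := hY.nabla hU hW
    have e : (fun x ↦ dirDeriv (fun y ↦ metric y (Z y) (W y)) x (Y x)) =ᶠ[nhds q]
        fun x ↦ metric x (nabla Y Z x) (W x) + metric x (Z x) (nabla Y W x) :=
      Filter.eventually_of_mem (hU.mem_nhds hq) fun x hx ↦
        dirDeriv_metric (hZ.mdiff hU hx) (hW.mdiff hU hx) _
    rw [dirDeriv_congr e, dirDeriv_add (metric_mdiff (hYZ.mdiff hU hq) (hW.mdiff hU hq))
      (metric_mdiff (hZ.mdiff hU hq) (hYW.mdiff hU hq)),
      dirDeriv_metric (hYZ.mdiff hU hq) (hW.mdiff hU hq),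
      dirDeriv_metric (hZ.mdiff hU hq) (hYW.mdiff hU hq)]
    rfl
  have h1 := dirDeriv_mlieBracket hU hq (SmoothFun.metric hZ hW) hX hY
  rw [key hX hY, key hY hX, dirDeriv_metric (hZ.mdiff hU hq) (hW.mdiff hU hq)] at h1
  simp only [curvOp_apply, metric_sub_left]
  rw [metric_comm (nabla X (nabla Y W) q), metric_comm (nabla Y (nabla X W) q),
    metric_comm (nabla _ W q)]
  simp only [nabla] at h1 ⊢
  linarith

section symmetries
variable (u v w z : TangentSpace (𝓡 n) q)

lemma riem_swap_left : riem q u v w z = -riem q v u w z := by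
  rw [riem_eq, curvAt_swap, metric_neg_left, riem_eq]

lemma riem_swap_right : riem q u v w z = -riem q u v z w := by
  have := metric_curvOp_swap (isOpen_frameDomain q) (mem_frameDomain q) (smoothField_localExt u)
    (smoothField_localExt v) (smoothField_localExt w) (smoothField_localExt z)
  simpa [riem] using this

lemma riem_cyclic : riem q u v w z + riem q v w u z + riem q w u v z = 0 := by
  simp only [riem_eq]
  rw [← metric_add_left, ← metric_add_left, curvAt_cyclic, metric_zero_left]

/-- The classical combination of the first Bianchi identity at the four cyclic shifts of `(u, v, w,
z)`, with cancellation by the two skew symmetries. -/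
lemma riem_pair : riem q u v w z = riem q w z u v := by
  linarith [riem_cyclic u v w z, riem_cyclic v w z u, riem_cyclic w z u v, riem_cyclic z u v w,
    riem_swap_right u v w z, riem_swap_right v w u z, riem_swap_right w u v z,
    riem_swap_right w z u v, riem_swap_right v z w u, riem_swap_right z u v w,
    riem_swap_left u w z v, riem_swap_left v z w u]

lemma ric_comm : ric q u v = ric q v u :=
  Finset.sum_congr rfl fun i _ ↦ by
    rw [riem_pair, riem_swap_left, riem_swap_right, neg_neg]

end symmetries

/-- `(∇_A R)(X, Y) Z`. -/
def nablaCurv (A X Y Z : Π x : M, TangentSpace (𝓡 n) x) (q : M) : TangentSpace (𝓡 n) q :=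
  nabla A (curvOp X Y Z) q - curvOp (nabla A X) Y Z q - curvOp X (nabla A Y) Z q
    - curvOp X Y (nabla A Z) q

/-- The second Bianchi identity. -/
lemma nablaCurv_cyclic (hU : IsOpen U) (hq : q ∈ U) (hA : SmoothField U A) (hX : SmoothField U X)
    (hY : SmoothField U Y) (hZ : SmoothField U Z) :
    nablaCurv A X Y Z q + nablaCurv X Y A Z q + nablaCurv Y A X Z q = 0 := by
  have h1 {A X Y : Π x : M, TangentSpace (𝓡 n) x} (hA : SmoothField U A) (hX : SmoothField U X)
      (hY : SmoothField U Y) : nabla A (curvOp X Y Z) q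
        = nabla A (nabla X (nabla Y Z)) q - nabla A (nabla Y (nabla X Z)) q
          - nabla A (nabla (VectorField.mlieBracket (𝓡 n) X Y) Z) q := by
    have a := (hX.nabla hU (hY.nabla hU hZ))
    have b := (hY.nabla hU (hX.nabla hU hZ))
    rw [curvOp_eq, nabla_sub ((a.sub b).mdiff hU hq)
      (((hX.mlieBracket hU hY).nabla hU hZ).mdiff hU hq), nabla_sub (a.mdiff hU hq) (b.mdiff hU hq)]
  -- In the cyclic sum the corrections in the first two slots of `R` pair up: by torsion-freeness
  -- each pair is `R([A, X], Y) Z`.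
  have h2 {A X Y : Π x : M, TangentSpace (𝓡 n) x} (hA : SmoothField U A) (hX : SmoothField U X)
      (hY : SmoothField U Y) : curvOp (nabla A X) Y Z q + curvOp Y (nabla X A) Z q
        = nabla (VectorField.mlieBracket (𝓡 n) A X) (nabla Y Z) q
          - nabla Y (nabla (VectorField.mlieBracket (𝓡 n) A X) Z) q
          + nabla (VectorField.mlieBracket (𝓡 n) Y (VectorField.mlieBracket (𝓡 n) A X)) Z q := by
    have e : curvOp (VectorField.mlieBracket (𝓡 n) A X) Y Z q
        = curvOp (nabla A X) Y Z q + curvOp Y (nabla X A) Z q := by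
      rw [curvOp_eq_curvAt hU hq (hA.mlieBracket hU hX) hY hZ,
        curvOp_eq_curvAt hU hq (hA.nabla hU hX) hY hZ,
        curvOp_eq_curvAt hU hq hY (hX.nabla hU hA) hZ,
        ← nabla_sub_nabla (hA.mdiff hU hq) (hX.mdiff hU hq), sub_eq_add_neg, curvAt_add_left,
        curvAt_swap (Y q), ← neg_one_smul ℝ (nabla X A q), curvAt_smul_left, neg_one_smul]
    have e2 : nabla (VectorField.mlieBracket (𝓡 n) (VectorField.mlieBracket (𝓡 n) A X) Y) Z q
        = - nabla (VectorField.mlieBracket (𝓡 n) Y (VectorField.mlieBracket (𝓡 n) A X)) Z q := by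
      simp only [nabla]
      rw [VectorField.mlieBracket_swap_apply, covDeriv_neg_right (hZ.mdiff hU hq)]
    rw [← e, curvOp_apply, e2]
    abel
  -- The double-bracket terms left by the three pairs vanish by the Jacobi identity.
  have h3 : nabla (VectorField.mlieBracket (𝓡 n) Y (VectorField.mlieBracket (𝓡 n) A X)) Z q
      + nabla (VectorField.mlieBracket (𝓡 n) A (VectorField.mlieBracket (𝓡 n) X Y)) Z q
      + nabla (VectorField.mlieBracket (𝓡 n) X (VectorField.mlieBracket (𝓡 n) Y A)) Z q = 0 := by
    have hZq := hZ.mdiff hU hq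
    simp only [nabla]
    rw [← covDeriv_add_right hZq, ← covDeriv_add_right hZq, mlieBracket_cyclic hU hq hY hA hX]
    simpa using covDeriv_smul_right hZq 0 0
  have a1 := h2 hA hX hY
  have a2 := h2 hX hY hA
  have a3 := h2 hY hA hX
  simp only [nablaCurv, h1 hA hX hY, h1 hX hY hA, h1 hY hA hX]
  simp only [curvOp_apply X Y (nabla _ _), curvOp_apply Y A (nabla _ _),
    curvOp_apply A X (nabla _ _)]
  rw [← eq_sub_iff_add_eq] at a1 a2 a3
  rw [a1, a2, a3]
  rw [← neg_eq_zero, ← h3]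
  abel

end RiemGeom
end

/-! ### Traces, the derivatives of Ricci and scalar curvature, and the contracted Bianchi identity.
-/

noncomputable section
namespace RiemGeom

variable {n : ℕ} {M : Type*} [TopologicalSpace M] [ChartedSpace (EuclideanSpace ℝ (Fin n)) M]
  [IsManifold (𝓡 n) ∞ M] [RiemannianBundle (fun x : M ↦ TangentSpace (𝓡 n) x)]

lemma metric_onb (p : M) (i j : Fin (Module.finrank ℝ (TangentSpace (𝓡 n) p))) :
    metric p (onb p i) (onb p j) = if i = j then 1 else 0 :=
  orthonormal_iff_ite.1 (onb p).orthonormal i j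

lemma sum_metric_smul_onb {p : M} (v : TangentSpace (𝓡 n) p) :
    ∑ i, metric p (onb p i) v • onb p i = v := (onb p).sum_repr' v

lemma gramInv_self (p : M) (i j) : gramInv (n := n) p i j p = if i = j then 1 else 0 := by
  have : gram (n := n) p p = 1 := by
    ext i j
    simp [gram, metric_onb, Matrix.one_apply]
  simp [gramInv, this, Matrix.one_apply]

/-- The trace of a bilinear form in terms of the local frame. -/
lemma sum_onb_eq_sum_gramInv {p x : M} (hx : x ∈ frameDomain (n := n) p)
    {B : TangentSpace (𝓡 n) x → TangentSpace (𝓡 n) x → ℝ} (hB : IsBilinearMap ℝ B) :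
    ∑ k, B (onb x k) (onb x k)
      = ∑ i, ∑ j, gramInv (n := n) p i j x * B (frame p j x) (frame p i x) := by
  set L := hB.toLinearMap with hL
  have hLB (u v) : B u v = L u v := rfl
  have h1 (k) : B (onb x k) (onb x k) = ∑ i, ∑ j, gramInv (n := n) p i j x *
      (metric x (onb x k) (frame p i x) * B (frame p j x) (onb x k)) := by
    have : L (onb x k) = L (∑ j, (∑ i, metric x (onb x k) (frame p i x)
        * gramInv (n := n) p i j x) • frame p j x) := by
      rw [sum_metric_gramInv_smul_frame hx]
    simp only [hLB]
    rw [this, map_sum, LinearMap.sum_apply, Finset.sum_comm]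
    refine Finset.sum_congr rfl fun j _ ↦ ?_
    rw [map_smul, LinearMap.smul_apply, smul_eq_mul, Finset.sum_mul]
    refine Finset.sum_congr rfl fun i _ ↦ ?_
    ring
  simp only [h1]
  rw [Finset.sum_comm]
  refine Finset.sum_congr rfl fun i _ ↦ ?_
  rw [Finset.sum_comm]
  refine Finset.sum_congr rfl fun j _ ↦ ?_
  rw [← Finset.mul_sum]
  congr 1
  simp only [hLB]
  conv_rhs => rw [← sum_metric_smul_onb (frame p i x), map_sum]
  exact Finset.sum_congr rfl fun k _ ↦ by rw [map_smul, smul_eq_mul]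

variable [IsContMDiffRiemannianBundle (𝓡 n) ∞ (EuclideanSpace ℝ (Fin n))
      (fun x : M ↦ TangentSpace (𝓡 n) x)]
  {A X X' Y Y' Z Z' W V : Π x : M, TangentSpace (𝓡 n) x} {p q : M} {U : Set M} {h : M → ℝ}

/-- Differentiating `G⁻¹ G = 1` at `p`, where `G = 1`, gives `dG⁻¹ = -dG`; metric compatibility
evaluates `dG`. -/
lemma dirDeriv_gramInv (p : M) (i j) (u : TangentSpace (𝓡 n) p) :
    dirDeriv (gramInv (n := n) p i j) p u
      = -(metric p (covDeriv (frame p i) p u) (onb p j)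
        + metric p (onb p i) (covDeriv (frame p j) p u)) := by
  have hU := isOpen_frameDomain (n := n) p
  have hp := mem_frameDomain (n := n) p
  have h1 := dirDeriv_congr (n := n) (Filter.eventually_of_mem (hU.mem_nhds hp)
    fun x hx ↦ sum_gramInv_mul_gram (n := n) (p := p) hx i j) u
  rw [dirDeriv_const, dirDeriv_sum _ _ fun k _ ↦
    (((smoothFun_gramInv p i k).mul (smoothFun_gram p k j)).mdiff hU hp)] at h1
  have h2 (k) : dirDeriv (fun x ↦ gramInv (n := n) p i k x * gram (n := n) p x k j) p u
      = (if i = k then 1 else 0) * dirDeriv (fun x ↦ gram (n := n) p x k j) p u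
        + (if k = j then 1 else 0) * dirDeriv (gramInv (n := n) p i k) p u := by
    rw [dirDeriv_mul ((smoothFun_gramInv p i k).mdiff hU hp) ((smoothFun_gram p k j).mdiff hU hp),
      gramInv_self]
    simp [gram, metric_onb]
  simp only [h2, Finset.sum_add_distrib, ite_mul, one_mul, zero_mul, Finset.sum_ite_eq,
    Finset.sum_ite_eq', Finset.mem_univ, if_true] at h1
  have h3 := dirDeriv_metric ((smoothField_frame p i).mdiff hU hp)
    ((smoothField_frame p j).mdiff hU hp) u
  simp only [gram] at h1
  rw [h3] at h1
  simp only [frame_self] at h1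
  linarith

/-- The derivative of the trace of a bilinear form field. -/
lemma dirDeriv_trace {T : Π x : M, TangentSpace (𝓡 n) x → TangentSpace (𝓡 n) x → ℝ} (p : M)
    (hT : ∀ x ∈ frameDomain (n := n) p, IsBilinearMap ℝ (T x))
    (hs : ∀ i j, SmoothFun (n := n) (frameDomain (n := n) p)
      (fun x ↦ T x (frame p i x) (frame p j x)))
    (u : TangentSpace (𝓡 n) p) :
    dirDeriv (fun x ↦ ∑ k, T x (onb x k) (onb x k)) p u
      = ∑ i, (dirDeriv (fun x ↦ T x (frame p i x) (frame p i x)) p u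
        - T p (covDeriv (frame p i) p u) (onb p i) - T p (onb p i) (covDeriv (frame p i) p u)) := by
  have hU := isOpen_frameDomain (n := n) p
  have hp := mem_frameDomain (n := n) p
  -- The bases `onb x` are chosen separately at each `x` and need not vary smoothly, so the trace is
  -- first rewritten in the smooth frame at `p`.
  have h1 := dirDeriv_congr (n := n) (Filter.eventually_of_mem (hU.mem_nhds hp)
    fun x hx ↦ sum_onb_eq_sum_gramInv (n := n) (p := p) hx (hT x hx)) u
  rw [h1, dirDeriv_sum _ _ fun i _ ↦ SmoothFun.mdiff (.sum fun j _ ↦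
    (smoothFun_gramInv p i j).mul (hs j i)) hU hp]
  have h2 (i j) : dirDeriv (fun x ↦ gramInv (n := n) p i j x * T x (frame p j x) (frame p i x)) p u
      = (if i = j then 1 else 0) * dirDeriv (fun x ↦ T x (frame p j x) (frame p i x)) p u
        - metric p (covDeriv (frame p i) p u) (onb p j) * T p (onb p j) (onb p i)
        - metric p (onb p i) (covDeriv (frame p j) p u) * T p (onb p j) (onb p i) := by
    rw [dirDeriv_mul ((smoothFun_gramInv p i j).mdiff hU hp) ((hs j i).mdiff hU hp), gramInv_self,
      dirDeriv_gramInv]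
    simp only [frame_self]
    ring
  have h3 (i) : dirDeriv
      (fun x ↦ ∑ j, gramInv (n := n) p i j x * T x (frame p j x) (frame p i x)) p u
      = dirDeriv (fun x ↦ T x (frame p i x) (frame p i x)) p u
        - ∑ j, metric p (covDeriv (frame p i) p u) (onb p j) * T p (onb p j) (onb p i)
        - ∑ j, metric p (onb p i) (covDeriv (frame p j) p u) * T p (onb p j) (onb p i) := by
    rw [dirDeriv_sum _ _ fun j _ ↦ ((smoothFun_gramInv p i j).mul (hs j i)).mdiff hU hp]
    simp only [h2, Finset.sum_sub_distrib, ite_mul, one_mul, zero_mul, Finset.sum_ite_eq,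
      Finset.mem_univ, if_true]
  simp only [h3, Finset.sum_sub_distrib]
  -- The derivative of the inverse Gram matrix supplies exactly the two connection terms, once the
  -- sums over the orthonormal basis are collapsed.
  rw [Finset.sum_comm (f := fun i j ↦ metric p (onb p i) (covDeriv (frame p j) p u)
    * T p (onb p j) (onb p i))]
  set L := (hT p hp).toLinearMap with hL
  have hLB (u v) : T p u v = L u v := rfl
  congr 1
  · congr 1
    refine Finset.sum_congr rfl fun i _ ↦ ?_
    simp only [hLB]
    conv_rhs => rw [← sum_metric_smul_onb (covDeriv (frame p i) p u), map_sum, LinearMap.sum_apply]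
    exact Finset.sum_congr rfl fun k _ ↦ by
      rw [map_smul, LinearMap.smul_apply, smul_eq_mul, metric_comm]
  · refine Finset.sum_congr rfl fun i _ ↦ ?_
    simp only [hLB]
    conv_rhs => rw [← sum_metric_smul_onb (covDeriv (frame p i) p u), map_sum]
    exact Finset.sum_congr rfl fun k _ ↦ by rw [map_smul, smul_eq_mul]

lemma riem_bilinear_outer (q : M) (v w : TangentSpace (𝓡 n) q) :
    IsBilinearMap ℝ (fun u z ↦ riem q u v w z) where
  add_left u u' z := by simp only [riem_eq, curvAt_add_left, metric_add_left]
  smul_left c u z := by simp only [riem_eq, curvAt_smul_left, metric_smul_left, smul_eq_mul]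
  add_right u z z' := by simp only [riem_eq, metric_add_right]
  smul_right c u z := by simp only [riem_eq, metric_smul_right, smul_eq_mul]

lemma ric_bilinear (q : M) : IsBilinearMap ℝ (ric (n := n) q) where
  add_left u u' z := by
    simp only [ric, riem_eq, curvAt_add_middle, metric_add_left, Finset.sum_add_distrib]
  smul_left c u z := by
    simp only [ric, riem_eq, curvAt_smul_middle, metric_smul_left, smul_eq_mul, Finset.mul_sum]
  add_right u z z' := by
    simp only [ric, riem_eq, curvAt_add_right, metric_add_left, Finset.sum_add_distrib]
  smul_right c u z := by
    simp only [ric, riem_eq, curvAt_smul_right, metric_smul_left, smul_eq_mul, Finset.mul_sum]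

lemma SmoothFun.riem (hU : IsOpen U) (hX : SmoothField U X) (hY : SmoothField U Y)
    (hZ : SmoothField U Z) (hW : SmoothField U W) :
    SmoothFun (n := n) U (fun x ↦ riem x (X x) (Y x) (Z x) (W x)) :=
  (SmoothFun.metric (hX.curvOp hU hY hZ) hW).congr fun x hx ↦ by
    rw [riem_eq, curvOp_eq_curvAt hU hx hX hY hZ]

lemma smoothFun_trace {T : Π x : M, TangentSpace (𝓡 n) x → TangentSpace (𝓡 n) x → ℝ} (p : M)
    (hT : ∀ x ∈ frameDomain (n := n) p, IsBilinearMap ℝ (T x))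
    (hs : ∀ i j, SmoothFun (n := n) (frameDomain (n := n) p)
      (fun x ↦ T x (frame p i x) (frame p j x))) :
    SmoothFun (n := n) (frameDomain (n := n) p) (fun x ↦ ∑ k, T x (onb x k) (onb x k)) :=
  (SmoothFun.sum fun i _ ↦ SmoothFun.sum fun j _ ↦ (smoothFun_gramInv p i j).mul (hs j i)).congr
    fun x hx ↦ sum_onb_eq_sum_gramInv hx (hT x hx)

lemma SmoothFun.ric (hX : SmoothField (frameDomain (n := n) p) X)
    (hY : SmoothField (frameDomain (n := n) p) Y) :
    SmoothFun (n := n) (frameDomain (n := n) p) (fun x ↦ ric x (X x) (Y x)) :=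
  smoothFun_trace (T := fun x u z ↦ RiemGeom.riem x u (X x) (Y x) z) p
    (fun x _ ↦ riem_bilinear_outer x _ _) fun i j ↦
      .riem (isOpen_frameDomain p) (smoothField_frame p i) hX hY (smoothField_frame p j)

lemma smoothFun_scal (p : M) : SmoothFun (n := n) (frameDomain (n := n) p) (scal n) :=
  smoothFun_trace p (fun x _ ↦ ric_bilinear x) fun i j ↦
    .ric (smoothField_frame p i) (smoothField_frame p j)

/-- The covariant derivative `(∇_a R)(u, v, w, z)` of the curvature tensor. -/
def nablaRiem (p : M) (a u v w z : TangentSpace (𝓡 n) p) : ℝ :=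
  metric p (nablaCurv (localExt a) (localExt u) (localExt v) (localExt w) p) z

section nablaRiem
variable (a u v w z : TangentSpace (𝓡 n) p)

lemma nablaRiem_eq : nablaRiem p a u v w z
    = dirDeriv (fun x ↦ riem x (localExt u x) (localExt v x) (localExt w x) (localExt z x)) p a
      - riem p (covDeriv (localExt u) p a) v w z - riem p u (covDeriv (localExt v) p a) w z
      - riem p u v (covDeriv (localExt w) p a) z - riem p u v w (covDeriv (localExt z) p a) := by
  have hU := isOpen_frameDomain (n := n) p
  have hp := mem_frameDomain (n := n) p
  have ha := smoothField_localExt a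
  have hu := smoothField_localExt u
  have hv := smoothField_localExt v
  have hw := smoothField_localExt w
  have hz := smoothField_localExt z
  have e := dirDeriv_congr (Filter.eventually_of_mem (hU.mem_nhds hp) fun x hx ↦
    (show riem x (localExt u x) (localExt v x) (localExt w x) (localExt z x)
      = metric x (curvOp (localExt u) (localExt v) (localExt w) x) (localExt z x) by
        rw [riem_eq, curvOp_eq_curvAt hU hx hu hv hw])) a
  rw [e, dirDeriv_metric ((hu.curvOp hU hv hw).mdiff hU hp) (hz.mdiff hU hp)]
  rw [nablaRiem, nablaCurv, curvOp_eq_curvAt hU hp (ha.nabla hU hu) hv hw,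
    curvOp_eq_curvAt hU hp hu (ha.nabla hU hv) hw, curvOp_eq_curvAt hU hp hu hv (ha.nabla hU hw),
    curvOp_eq_curvAt hU hp hu hv hw]
  simp only [riem_eq, nabla, localExt_self, metric_sub_left]
  ring

/-- Symmetries of `R` are inherited by `∇R`: the derivative term and each correction term change
sign. -/
lemma nablaRiem_swap_left : nablaRiem p a u v w z = -nablaRiem p a v u w z := by
  rw [nablaRiem_eq, nablaRiem_eq]
  have hU := isOpen_frameDomain (n := n) p
  have hp := mem_frameDomain (n := n) p
  have e : (fun x ↦ riem x (localExt u x) (localExt v x) (localExt w x) (localExt z x))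
      = fun x ↦ (-1) * riem x (localExt v x) (localExt u x) (localExt w x) (localExt z x) := by
    funext x; rw [riem_swap_left]; ring
  rw [e, dirDeriv_const_mul _ (SmoothFun.mdiff (.riem hU (smoothField_localExt v)
    (smoothField_localExt u) (smoothField_localExt w) (smoothField_localExt z)) hU hp),
    riem_swap_left _ v, riem_swap_left u, riem_swap_left u v, riem_swap_left u v]
  ring

lemma nablaRiem_swap_right : nablaRiem p a u v w z = -nablaRiem p a u v z w := by
  rw [nablaRiem_eq, nablaRiem_eq]
  have hU := isOpen_frameDomain (n := n) p
  have hp := mem_frameDomain (n := n) p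
  have e : (fun x ↦ riem x (localExt u x) (localExt v x) (localExt w x) (localExt z x))
      = fun x ↦ (-1) * riem x (localExt u x) (localExt v x) (localExt z x) (localExt w x) := by
    funext x; rw [riem_swap_right]; ring
  rw [e, dirDeriv_const_mul _ (SmoothFun.mdiff (.riem hU (smoothField_localExt u)
    (smoothField_localExt v) (smoothField_localExt z) (smoothField_localExt w)) hU hp),
    riem_swap_right _ v w, riem_swap_right u _ w, riem_swap_right u v _ z, riem_swap_right u v w]
  ring

lemma nablaRiem_cyclic :
    nablaRiem p a u v w z + nablaRiem p u v a w z + nablaRiem p v a u w z = 0 := by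
  simp only [nablaRiem]
  rw [← metric_add_left, ← metric_add_left, nablaCurv_cyclic (isOpen_frameDomain p)
    (mem_frameDomain p) (smoothField_localExt a) (smoothField_localExt u) (smoothField_localExt v)
    (smoothField_localExt w), metric_zero_left]

/-- Contraction commutes with `∇`, by `dirDeriv_trace`. -/
lemma covDerivTensor_ric :
    covDerivTensor ric p a v w = ∑ i, nablaRiem p a (onb p i) v w (onb p i) := by
  have h1 := dirDeriv_trace (T := fun x u z ↦ riem x u (localExt v x) (localExt w x) z) p
    (fun x _ ↦ riem_bilinear_outer x _ _) (fun i j ↦ .riem (isOpen_frameDomain p)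
      (smoothField_frame p i) (smoothField_localExt v) (smoothField_localExt w)
      (smoothField_frame p j)) a
  simp only [localExt_self] at h1
  simp only [covDerivTensor, nablaRiem_eq]
  simp only [ric]
  rw [h1, ← Finset.sum_sub_distrib, ← Finset.sum_sub_distrib]
  refine Finset.sum_congr rfl fun i _ ↦ ?_
  change _ = dirDeriv (fun x ↦ riem x (frame p i x) _ _ (frame p i x)) p a
      - riem p (covDeriv (frame p i) p a) v w _ - _ - _ - riem p _ v w (covDeriv (frame p i) p a)
  ring

lemma dirDeriv_scal :
    dirDeriv (scal n) p a = ∑ i, covDerivTensor ric p a (onb p i) (onb p i) :=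
  dirDeriv_trace p (fun x _ ↦ ric_bilinear x) (fun i j ↦
    .ric (smoothField_frame p i) (smoothField_frame p j)) a

/-- The contracted second Bianchi identity. -/
lemma dirDeriv_scal_eq_two_mul_div_ric :
    dirDeriv (scal n) p a = 2 * ∑ i, covDerivTensor ric p (onb p i) a (onb p i) := by
  have h (i j) := nablaRiem_cyclic a (onb p i) (onb p j) (onb p j) (onb p i)
  -- After summation over `i` and `j`, each term on the right becomes the divergence of `Ric`.
  have h' (i j) : nablaRiem p a (onb p i) (onb p j) (onb p j) (onb p i)
      = nablaRiem p (onb p i) (onb p j) a (onb p i) (onb p j)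
        + nablaRiem p (onb p j) (onb p i) a (onb p j) (onb p i) := by
    have := h i j
    rw [nablaRiem_swap_right (onb p i), nablaRiem_swap_left (onb p j) a] at this
    linarith
  rw [dirDeriv_scal]
  simp only [covDerivTensor_ric, h', Finset.sum_add_distrib]
  rw [Finset.sum_comm]
  ring

end nablaRiem

end RiemGeom
end

/-! ### Consequences of the Einstein equation. -/

noncomputable section
namespace RiemGeom

variable {n : ℕ} {M : Type*} [TopologicalSpace M] [ChartedSpace (EuclideanSpace ℝ (Fin n)) M]
  [IsManifold (𝓡 n) ∞ M] [RiemannianBundle (fun x : M ↦ TangentSpace (𝓡 n) x)]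
  [IsContMDiffRiemannianBundle (𝓡 n) ∞ (EuclideanSpace ℝ (Fin n))
      (fun x : M ↦ TangentSpace (𝓡 n) x)]
  {p : M} {f : M → ℝ} {lam m : ℝ}

/-- The expansion of `[u, v] f` by metric compatibility, together with torsion-freeness, leaves
exactly the skew part of the Hessian. -/
lemma hess_comm (hf : ContMDiff (𝓡 n) 𝓘(ℝ) ∞ f) (u v : TangentSpace (𝓡 n) p) :
    hess f p u v = hess f p v u := by
  have hU := isOpen_frameDomain (n := n) p
  have hp := mem_frameDomain (n := n) p
  have hfU : SmoothFun (n := n) (frameDomain (n := n) p) f := hf.contMDiffOn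
  have hgrad := SmoothField.grad hU hfU
  have hu := smoothField_localExt u
  have hv := smoothField_localExt v
  have h1 := dirDeriv_mlieBracket hU hp hfU hu hv
  have hg (x : M) (w : TangentSpace (𝓡 n) x) : dirDeriv f x w = metric x (grad f x) w :=
    (metric_grad w f).symm
  simp only [hg] at h1
  rw [dirDeriv_metric (hgrad.mdiff hU hp) (hv.mdiff hU hp),
    dirDeriv_metric (hgrad.mdiff hU hp) (hu.mdiff hU hp),
    ← covDeriv_sub_covDeriv (hu.mdiff hU hp) (hv.mdiff hU hp), metric_sub_right] at h1
  simp only [localExt_self] at h1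
  simp only [hess]
  linarith

/-- The covariant derivative of the Ricci tensor, from the Einstein equation. -/
lemma EinsteinEquation.covDerivTensor_ric (hE : EinsteinEquation n lam m f)
    (hf : ContMDiff (𝓡 n) 𝓘(ℝ) ∞ f) (u v w : TangentSpace (𝓡 n) p) :
    covDerivTensor ric p u v w
      = -(metric p (nabla (localExt u) (nabla (localExt v) (grad f)) p) w
          - metric p (covDeriv (grad f) p (nabla (localExt u) (localExt v) p)) w)
        + (1 / m) * (hess f p u v * dirDeriv f p w + dirDeriv f p v * hess f p u w) := by
  have hU := isOpen_frameDomain (n := n) p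
  have hp := mem_frameDomain (n := n) p
  have hfU : SmoothFun (n := n) (frameDomain (n := n) p) f := hf.contMDiffOn
  have hgrad := SmoothField.grad hU hfU
  have hv := smoothField_localExt v
  have hw := smoothField_localExt w
  have hnv := hv.nabla hU hgrad
  have hric (x : M) (a b : TangentSpace (𝓡 n) x) : ric x a b = lam * metric x a b
      - metric x (covDeriv (grad f) x a) b
      + (1 / m) * (metric x (grad f x) a * metric x (grad f x) b) := by
    have := hE x a b
    simp only [metric_grad]
    simp only [hess] at this
    linarith
  have d1 := SmoothFun.mdiff (.metric hv hw) hU hp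
  have d2 := SmoothFun.mdiff (.metric hnv hw) hU hp
  have d3 := SmoothFun.mdiff (.metric hgrad hv) hU hp
  have d4 := SmoothFun.mdiff (.metric hgrad hw) hU hp
  have d5 : DiffFunAt (n := n) (fun x ↦ lam * metric x (localExt v x) (localExt w x)) p :=
    SmoothFun.mdiff ((smoothFun_const lam).mul (.metric hv hw)) hU hp
  have d52 := SmoothFun.mdiff (((smoothFun_const lam).mul (.metric hv hw)).sub
    (.metric hnv hw)) hU hp
  have d34 := SmoothFun.mdiff ((SmoothFun.metric hgrad hv).mul (.metric hgrad hw)) hU hp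
  have d6 : DiffFunAt (n := n) (fun x ↦ (1 / m) * (metric x (grad f x) (localExt v x)
      * metric x (grad f x) (localExt w x))) p :=
    SmoothFun.mdiff ((smoothFun_const (1 / m)).mul ((SmoothFun.metric hgrad hv).mul
      (.metric hgrad hw))) hU hp
  have e : (fun x ↦ ric x (localExt v x) (localExt w x)) = fun x ↦
      lam * metric x (localExt v x) (localExt w x)
        - metric x (nabla (localExt v) (grad f) x) (localExt w x)
      + (1 / m) * (metric x (grad f x) (localExt v x) * metric x (grad f x) (localExt w x)) := by
    funext x
    exact hric x _ _
  rw [covDerivTensor, e, dirDeriv_add d52 d6, dirDeriv_sub d5 d2, dirDeriv_const_mul _ d1,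
    dirDeriv_const_mul _ d34, dirDeriv_mul d3 d4,
    dirDeriv_metric (hv.mdiff hU hp) (hw.mdiff hU hp),
    dirDeriv_metric (hnv.mdiff hU hp) (hw.mdiff hU hp),
    dirDeriv_metric (hgrad.mdiff hU hp) (hw.mdiff hU hp),
    dirDeriv_metric (hgrad.mdiff hU hp) (hv.mdiff hU hp), hric, hric]
  simp only [nabla, hess, ← metric_grad, localExt_self]
  ring

/-- The skew part of `∇ Ric`, from the Ricci identity for `∇ f`. -/
lemma EinsteinEquation.covDerivTensor_ric_sub (hE : EinsteinEquation n lam m f)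
    (hf : ContMDiff (𝓡 n) 𝓘(ℝ) ∞ f) (u v w : TangentSpace (𝓡 n) p) :
    covDerivTensor ric p u v w - covDerivTensor ric p v u w
      = riem p u v w (grad f p)
        + (1 / m) * (dirDeriv f p v * (lam * metric p u w - ric p u w)
          - dirDeriv f p u * (lam * metric p v w - ric p v w)) := by
  have hU := isOpen_frameDomain (n := n) p
  have hp := mem_frameDomain (n := n) p
  have hgrad := SmoothField.grad (n := n) hU hf.contMDiffOn
  have hu := smoothField_localExt u
  have hv := smoothField_localExt v
  have h1 : metric p (curvOp (localExt u) (localExt v) (grad f) p) w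
      = -riem p u v w (grad f p) := by
    rw [curvOp_eq_curvAt hU hp hu hv hgrad, ← riem_eq, riem_swap_right]
    simp only [localExt_self]
  -- Torsion-freeness matches the last term of the curvature operator with the lower-order terms of
  -- the two second covariant derivatives.
  have h2 : nabla (VectorField.mlieBracket (𝓡 n) (localExt u) (localExt v)) (grad f) p
      = covDeriv (grad f) p (nabla (localExt u) (localExt v) p)
        - covDeriv (grad f) p (nabla (localExt v) (localExt u) p) := by
    rw [← covDeriv_sub_right (hgrad.mdiff hU hp), nabla_sub_nabla (hu.mdiff hU hp) (hv.mdiff hU hp)]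
    rfl
  rw [curvOp_apply, h2] at h1
  simp only [metric_sub_left] at h1
  have h3 (a b : TangentSpace (𝓡 n) p) : hess f p a b
      = lam * metric p a b - ric p a b + (1 / m) * (dirDeriv f p a * dirDeriv f p b) := by
    linarith [hE p a b]
  rw [hE.covDerivTensor_ric hf, hE.covDerivTensor_ric hf, hess_comm hf v u]
  have h4 := h3 u w
  have h5 := h3 v w
  -- The remaining Hessians are replaced through the equation; the resulting cubic terms in `df`
  -- cancel.
  linear_combination -h1 + (1 / m) * dirDeriv f p v * h4 - (1 / m) * dirDeriv f p u * h5

/-- The derivative of the scalar curvature, from the Einstein equation. -/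
lemma EinsteinEquation.dirDeriv_scal (hE : EinsteinEquation n lam m f)
    (hf : ContMDiff (𝓡 n) 𝓘(ℝ) ∞ f) (u : TangentSpace (𝓡 n) p) :
    1 / 2 * dirDeriv (scal n) p u = ric p u (grad f p)
      + (1 / m) * (lam * dirDeriv f p u - ric p u (grad f p)
        - dirDeriv f p u * (lam * n - scal n p)) := by
  -- The trace of the skew part of `∇ Ric` over its last two arguments is `d scal - div Ric`, and
  -- `div Ric = ½ d scal`.
  have h1 : dirDeriv (scal n) p u - 1 / 2 * dirDeriv (scal n) p u
      = ∑ i, (riem p u (onb p i) (onb p i) (grad f p)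
        + (1 / m) * (dirDeriv f p (onb p i) * (lam * metric p u (onb p i) - ric p u (onb p i))
          - dirDeriv f p u
            * (lam * metric p (onb p i) (onb p i) - ric p (onb p i) (onb p i)))) := by
    have h0 : 1 / 2 * dirDeriv (scal n) p u
        = ∑ i, covDerivTensor ric p (onb p i) u (onb p i) := by
      rw [dirDeriv_scal_eq_two_mul_div_ric]
      ring
    rw [h0, RiemGeom.dirDeriv_scal]
    rw [← Finset.sum_sub_distrib]
    exact Finset.sum_congr rfl fun i _ ↦ hE.covDerivTensor_ric_sub hf _ _ _
  have hg : grad f p = ∑ i, dirDeriv f p (onb (n := n) p i) • onb p i := by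
    conv_lhs => rw [← sum_metric_smul_onb (n := n) (grad f p)]
    exact Finset.sum_congr rfl fun i _ ↦ by rw [metric_comm, metric_grad]
  have h2 : ∑ i, riem p u (onb p i) (onb p i) (grad f p) = ric p u (grad f p) := by
    rw [ric_comm]
    exact Finset.sum_congr rfl fun i _ ↦ riem_pair _ _ _ _
  have h3 : ∑ i, dirDeriv f p (onb p i) * metric p u (onb p i) = dirDeriv f p u := by
    rw [← metric_grad u f, metric_comm, hg, metric_sum_right]
    simp only [metric_smul_right]
  have h4 : ∑ i, dirDeriv f p (onb p i) * ric p u (onb p i) = ric p u (grad f p) := by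
    have hB (v : TangentSpace (𝓡 n) p) : ric p u v =
        (ric_bilinear (n := n) p).toLinearMap u v := rfl
    rw [hg, hB, map_sum]
    exact Finset.sum_congr rfl fun i _ ↦ by rw [map_smul, smul_eq_mul]; rfl
  have h5 : ∑ i, metric p (onb (n := n) p i) (onb (n := n) p i) = n := by
    have : Module.finrank ℝ (TangentSpace (𝓡 n) p) = n :=
      finrank_euclideanSpace_fin (𝕜 := ℝ)
    simp [metric_onb, this]
  have h6 : ∑ i, ric p (onb p i) (onb p i) = scal n p := rfl
  rw [Finset.sum_add_distrib, h2, ← Finset.mul_sum, Finset.sum_sub_distrib, ← Finset.mul_sum,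
    Finset.sum_sub_distrib, ← Finset.mul_sum, h5, h6] at h1
  simp only [mul_sub, Finset.sum_sub_distrib, h4, mul_left_comm _ lam, ← Finset.mul_sum, h3] at h1
  linear_combination h1

/-- Since `∇g = 0`, only the factor `scal` is differentiated in the metric part. -/
lemma covDerivTensor_schouten (u v w : TangentSpace (𝓡 n) p) :
    covDerivTensor schouten p u v w = covDerivTensor ric p u v w
      - 1 / (2 * ((n : ℝ) - 1)) * dirDeriv (scal n) p u * metric p v w := by
  have hU := isOpen_frameDomain (n := n) p
  have hp := mem_frameDomain (n := n) p
  have hv := smoothField_localExt v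
  have hw := smoothField_localExt w
  have e : (fun x ↦ schouten x (localExt v x) (localExt w x)) = fun x ↦
      ric x (localExt v x) (localExt w x)
        - 1 / (2 * ((n : ℝ) - 1)) * (scal n x * metric x (localExt v x) (localExt w x)) := by
    funext x
    simp only [schouten]
    ring
  have d1 := SmoothFun.mdiff (.ric hv hw) hU hp
  have d2 := (smoothFun_scal (n := n) p).mdiff hU hp
  have d3 := SmoothFun.mdiff (.metric hv hw) hU hp
  have d23 := SmoothFun.mdiff ((smoothFun_scal (n := n) p).mul (.metric hv hw)) hU hp
  have d4 : DiffFunAt (n := n) (fun x ↦ 1 / (2 * ((n : ℝ) - 1))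
      * (scal n x * metric x (localExt v x) (localExt w x))) p :=
    SmoothFun.mdiff ((smoothFun_const _).mul ((smoothFun_scal p).mul (.metric hv hw))) hU hp
  simp only [covDerivTensor]
  rw [e, dirDeriv_sub d1 d4, dirDeriv_const_mul _ d23, dirDeriv_mul d2 d3,
    dirDeriv_metric (hv.mdiff hU hp) (hw.mdiff hU hp)]
  simp only [schouten, localExt_self]
  ring

end RiemGeom
end

theorem lemma3p1 {n : ℕ} (hn : 3 ≤ n) {M : Type*} [TopologicalSpace M] [T2Space M]
    [ChartedSpace (EuclideanSpace ℝ (Fin n)) M] [IsManifold (𝓡 n) ∞ M]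
    [RiemannianBundle (fun x : M ↦ TangentSpace (𝓡 n) x)]
    [IsContMDiffRiemannianBundle (𝓡 n) ∞ (EuclideanSpace ℝ (Fin n))
      (fun x : M ↦ TangentSpace (𝓡 n) x)]
    (f : M → ℝ) (hf : ContMDiff (𝓡 n) 𝓘(ℝ) ∞ f)
    (lam m : ℝ) (hm : m ≠ 0) (hE : RiemGeom.EinsteinEquation n lam m f)
    (p : M) (X Y Z : TangentSpace (𝓡 n) p) :
    RiemGeom.cotton p X Y Z =
      RiemGeom.weyl p X Y Z (RiemGeom.grad f p)
        + (m + n - 2) / m * RiemGeom.dTensor f p X Y Z := by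
  have hn' : (3 : ℝ) ≤ n := by exact_mod_cast hn
  have h1 : (n : ℝ) - 1 ≠ 0 := by linarith
  have h2 : (n : ℝ) - 2 ≠ 0 := by linarith
  have hR := hE.covDerivTensor_ric_sub hf X Y Z
  have hX := hE.dirDeriv_scal hf X
  have hY := hE.dirDeriv_scal hf Y
  rw [← RiemGeom.metric_grad X f, RiemGeom.metric_comm] at hX
  rw [← RiemGeom.metric_grad Y f, RiemGeom.metric_comm] at hY
  rw [← RiemGeom.metric_grad, ← RiemGeom.metric_grad, RiemGeom.metric_comm (RiemGeom.grad f p) Y,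
    RiemGeom.metric_comm (RiemGeom.grad f p) X] at hR
  simp only [RiemGeom.cotton, RiemGeom.covDerivTensor_schouten, RiemGeom.weyl,
    RiemGeom.kulkarniNomizu, RiemGeom.dTensor]
  have hR' := eq_add_of_sub_eq hR
  -- This exposes the factor `½ d scal`, the form in which `hX` and `hY` can be substituted.
  have hX' : RiemGeom.dirDeriv (RiemGeom.scal n) p X
      = 2 * (1 / 2 * RiemGeom.dirDeriv (RiemGeom.scal n) p X) := by ring
  have hY' : RiemGeom.dirDeriv (RiemGeom.scal n) p Y
      = 2 * (1 / 2 * RiemGeom.dirDeriv (RiemGeom.scal n) p Y) := by ring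
  rw [hR', hX', hY', hX, hY]
  field_simp
  ring
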